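/- Let $n\ge p$, let $X_1,\dots,X_n$ be independent $N_p(0,\Sigma)$ vectors with $\Sigma$ positive definite, and put $A=\sum_{i=1}^n X_iX_i'$. For a positive definite $p\times p$ matrix $M$ let $M_{(1)}=M$ and let $M_{(k+1)}$ be the Schur complement of the top left entry $m_{(k)11}$ in $M_{(k)}$; the full Iwasawa reduction of $M$ is $M^*=\mathrm{Diag}(m_{(1)11},\dots,m_{(p)11})$. This defines $\Sigma^*$ and (almost surely) $A^*$. For positive definite $\phi$ and $S$ let $L(\phi,S)=\mathrm{tr}(S^{-1}\phi)-\log\det(S^{-1}\phi)-p$ be the Stein (likelihood) loss. Estimators of $\Sigma^*$ are measurable maps $\phi$ from the positive diagonal matrices to the positive definite matrices, applied to $A^*$, with risk $R(\phi,\Sigma^*)=\mathcal E_\Sigma L(\phi(A^*),\Sigma^*)\in[0,\infty]$. Such an estimator is called invariant if $\phi(gag')=g\,\phi(a)\,g'$ for all positive diagonal matrices $g$ and $a$. Theorem 1. (a) The estimator $\hat\Sigma^*_I=D_0^{-1}A^*$, where $D_0$ is diagonal with entries $d_{0ii}=n-i+1$, is invariant, and it is the unique best invariant estimator: for every invariant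 estimator $\phi$ and every positive definite $\Sigma$, $R(\hat\Sigma^*_I,\Sigma^*)\le R(\phi,\Sigma^*)$, with equality only if $\phi(a)=D_0^{-1}a$ for all positive diagonal $a$. (b) Each $\log\chi^2_{n-i+1}$, $1\le i\le p$, is integrable, and for every positive definite $\Sigma$ the minimum risk is $$R(\hat\Sigma^*_I,\Sigma^*)=\sum_{i=1}^p\{\log(n-i+1)-\mathcal E[\log\chi^2_{n-i+1}]\}<\infty .$$ (c) $\hat\Sigma^*_I$ is minimax: $\sup_{\Sigma}R(\hat\Sigma^*_I,\Sigma^*)\le\sup_{\Sigma}R(\phi,\Sigma^*)$ for every estimator $\phi$ (invariant or not), the suprema being over all positive definite $\Sigma$. (d) Let $T$ be the lower triangular matrix with positive diagonal such that $A=TT'$, let $\hat\Sigma_S=TD_S^{-1}T'$ with $D_S=\mathrm{Diag}(n+p-2i+1)_{1\le i\le p}$ be the Cholesky (James–Stein) estimator and $\hat\Sigma=n^{-1}A$ the maximum likelihood estimator of $\Sigma$. Then, for every positive definite $\Sigma$, $$R(\hat\Sigma^*_I,\Sigma^*)\le \mathcal E_\Sigma L(\hat\Sigma_S,\Sigma)\le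 \mathcal E_\Sigma L(\hat\Sigma,\Sigma).$$ -/

import Mathlib

open MeasureTheory ProbabilityTheory Matrix
open scoped ENNReal

namespace Iwasawa

/-- The Schur complement `M₂₂ - M₂₁ M₁₂ / m₁₁` of the top left entry of a square matrix. -/
noncomputable def schur {p : ℕ} (M : Matrix (Fin (p + 1)) (Fin (p + 1)) ℝ) :
    Matrix (Fin p) (Fin p) ℝ :=
  Matrix.of fun i j => M i.succ j.succ - M i.succ 0 * M 0 j.succ / M 0 0

/-- The successive pivots: `M_(1) = M`, `M_(k+1)` is the Schur complement of the top left entry of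
`M_(k)`, and the `k`-th pivot is the top left entry of `M_(k)`. -/
noncomputable def pivots : (p : ℕ) → Matrix (Fin p) (Fin p) ℝ → Fin p → ℝ
  | 0, _ => Fin.elim0
  | p + 1, M => vecCons (M 0 0) (pivots p (schur M))

/-- The full Iwasawa reduction `M ↦ M* = Diag(m_(1)11, …, m_(p)11)`. -/
noncomputable def reduce {p : ℕ} (M : Matrix (Fin p) (Fin p) ℝ) : Matrix (Fin p) (Fin p) ℝ :=
  Matrix.diagonal (pivots p M)

/-- The Cholesky factor of a positive definite matrix, column by column. -/
noncomputable def cholesky : (p : ℕ) → Matrix (Fin p) (Fin p) ℝ → Matrix (Fin p) (Fin p) ℝ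
  | 0, _ => 0
  | p + 1, M => Matrix.of (vecCons (vecCons (Real.sqrt (M 0 0)) 0)
      (fun i => vecCons (M i.succ 0 / Real.sqrt (M 0 0)) (cholesky p (schur M) i)))

theorem schur_posDef {p : ℕ} {M : Matrix (Fin (p + 1)) (Fin (p + 1)) ℝ} (hM : M.PosDef) :
    (schur M).PosDef := by
  have h0 : 0 < M 0 0 := hM.diag_pos
  have hs : ∀ i j, M i j = M j i := fun i j => by
    have := hM.isHermitian.apply i j
    simpa using this.symm
  refine Matrix.PosDef.of_dotProduct_mulVec_pos ?_ ?_
  · ext i j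
    simp only [schur, conjTranspose_apply, of_apply, star_trivial]
    rw [hs j.succ i.succ, hs j.succ 0, hs 0 i.succ]
    ring
  · intro x hx
    have hy : (vecCons (-(∑ j : Fin p, M 0 j.succ * x j) / M 0 0) x : Fin (p + 1) → ℝ) ≠ 0 := by
      intro h
      apply hx
      funext i
      simpa using congrFun h i.succ
    have hpos := hM.dotProduct_mulVec_pos hy
    have e : ∑ i : Fin p, x i * (M i.succ 0 * (-(∑ j : Fin p, M 0 j.succ * x j) / M 0 0))
        = -(∑ j : Fin p, M 0 j.succ * x j) / M 0 0 * (∑ j : Fin p, M 0 j.succ * x j) := by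
      rw [Finset.mul_sum]
      refine Finset.sum_congr rfl fun i _ => ?_
      rw [hs i.succ 0]; ring
    have e2 : ∑ i : Fin p, x i * ∑ j : Fin p, M i.succ 0 * M 0 j.succ / M 0 0 * x j
        = (∑ j : Fin p, M 0 j.succ * x j) / M 0 0 * (∑ j : Fin p, M 0 j.succ * x j) := by
      rw [Finset.mul_sum]
      refine Finset.sum_congr rfl fun i _ => ?_
      rw [hs i.succ 0, Finset.mul_sum, Finset.sum_div, Finset.sum_mul]
      refine Finset.sum_congr rfl fun j _ => ?_
      ring
    have hz : M 0 0 * (-(∑ j : Fin p, M 0 j.succ * x j) / M 0 0)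
        = -(∑ j : Fin p, M 0 j.succ * x j) := by field_simp
    simp only [dotProduct, mulVec, Fin.sum_univ_succ, star_trivial, Pi.star_apply, cons_val_zero,
      cons_val_succ, hz, mul_add, Finset.sum_add_distrib, e] at hpos
    simp only [dotProduct, mulVec, schur, of_apply, sub_mul, Finset.sum_sub_distrib, mul_sub,
      star_trivial, Pi.star_apply, e2]
    ring_nf at hpos ⊢
    linarith [hpos]

/-- `cholesky p M` is the lower triangular matrix `T` with positive diagonal and `T Tᵀ = M`. -/
theorem cholesky_spec : ∀ (p : ℕ) (M : Matrix (Fin p) (Fin p) ℝ), M.PosDef →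
    (∀ i j, i < j → cholesky p M i j = 0) ∧ (∀ i, 0 < cholesky p M i i) ∧
      cholesky p M * (cholesky p M)ᵀ = M
  | 0, M, _ => ⟨fun i => i.elim0, fun i => i.elim0, by ext i; exact i.elim0⟩
  | p + 1, M, hM => by
    obtain ⟨h1, h2, h3⟩ := cholesky_spec p (schur M) (schur_posDef hM)
    have h0 : 0 < M 0 0 := hM.diag_pos
    have hs : ∀ i j, M i j = M j i := fun i j => by
      have := hM.isHermitian.apply i j
      simpa using this.symm
    have hq := Real.mul_self_sqrt h0.le
    have hq0 : Real.sqrt (M 0 0) ≠ 0 := (Real.sqrt_pos.2 h0).ne'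
    refine ⟨?_, ?_, ?_⟩
    · intro i j hij
      refine Fin.cases ?_ (fun j => ?_) j hij
      · intro h; exact absurd h (Fin.not_lt_zero _)
      · refine Fin.cases ?_ (fun i => ?_) i
        · intro _; simp [cholesky]
        · intro h; simpa [cholesky] using h1 i j (Fin.succ_lt_succ_iff.1 h)
    · intro i
      refine Fin.cases ?_ (fun i => ?_) i
      · simpa [cholesky] using h0
      · simpa [cholesky] using h2 i
    · ext i j
      have h3' := fun i j => congrFun (congrFun h3 i) j
      simp only [mul_apply, transpose_apply] at h3'
      refine Fin.cases ?_ (fun j => ?_) j <;> refine Fin.cases ?_ (fun i => ?_) i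
      · simp [cholesky, mul_apply, Fin.sum_univ_succ, hq]
      · simp [cholesky, mul_apply, Fin.sum_univ_succ, hq0]
      · simp [cholesky, mul_apply, Fin.sum_univ_succ, mul_div_cancel₀, hq0, hs 0 j.succ]
      · have h := h3' i j
        simp only [mul_apply, transpose_apply, Fin.sum_univ_succ, cholesky, of_apply,
          cons_val_zero, cons_val_succ, h]
        rw [div_mul_div_comm, hq, hs j.succ 0]
        simp [schur]

/-- The Stein (likelihood) loss `tr(Σ⁻¹ φ) - log det(Σ⁻¹ φ) - p`. -/
noncomputable def steinLoss {p : ℕ} (φ S : Matrix (Fin p) (Fin p) ℝ) : ℝ :=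
  (S⁻¹ * φ).trace - Real.log (S⁻¹ * φ).det - p

/-- The law of a sample of `n` independent vectors with law `N_p(0, Σ)`. -/
noncomputable def sampleLaw (n : ℕ) {p : ℕ} (S : Matrix (Fin p) (Fin p) ℝ) :
    Measure (Fin n → EuclideanSpace ℝ (Fin p)) :=
  Measure.pi fun _ => multivariateGaussian 0 S

/-- The sufficient statistic `A = ∑ Xᵢ Xᵢ'`. -/
def scatter {n p : ℕ} (X : Fin n → EuclideanSpace ℝ (Fin p)) : Matrix (Fin p) (Fin p) ℝ :=
  ∑ i, vecMulVec (X i).ofLp (X i).ofLp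

/-- The risk `E L(ψ(A), Σ)` of the estimator `ψ(A)` of `Σ`, an element of `[0, ∞]` (the loss is
nonnegative when its arguments are positive definite). -/
noncomputable def risk (n : ℕ) {p : ℕ}
    (ψ : Matrix (Fin p) (Fin p) ℝ → Matrix (Fin p) (Fin p) ℝ)
    (S : Matrix (Fin p) (Fin p) ℝ) : ℝ≥0∞ :=
  ∫⁻ X, ENNReal.ofReal (steinLoss (ψ (scatter X)) S) ∂(sampleLaw n S)

/-- The risk `E L(φ(A*), Σ*)` of the estimator `φ(A*)` of `Σ*`, for data with covariance `Σ`. -/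
noncomputable def starRisk (n : ℕ) {p : ℕ}
    (φ : Matrix (Fin p) (Fin p) ℝ → Matrix (Fin p) (Fin p) ℝ)
    (S : Matrix (Fin p) (Fin p) ℝ) : ℝ≥0∞ :=
  ∫⁻ X, ENNReal.ofReal (steinLoss (φ (reduce (scatter X))) (reduce S)) ∂(sampleLaw n S)

/-- Estimators `φ(A*)`: measurable maps from the positive diagonal matrices to the positive
definite matrices (values of `φ` at other arguments are irrelevant). -/
structure IsEstimator {p : ℕ} (φ : Matrix (Fin p) (Fin p) ℝ → Matrix (Fin p) (Fin p) ℝ) :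
    Prop where
  posDef : ∀ a : Fin p → ℝ, (∀ i, 0 < a i) → (φ (diagonal a)).PosDef
  measurable : ∀ i j, Measurable fun a : {a : Fin p → ℝ // ∀ i, 0 < a i} => φ (diagonal a.1) i j

/-- Invariance (equivariance) for the action `M ↦ g M g'` of the group of positive diagonal
matrices. -/
def IsInvariant {p : ℕ} (φ : Matrix (Fin p) (Fin p) ℝ → Matrix (Fin p) (Fin p) ℝ) : Prop :=
  ∀ g a : Fin p → ℝ, (∀ i, 0 < g i) → (∀ i, 0 < a i) →
    φ (diagonal g * diagonal a * (diagonal g)ᵀ) = diagonal g * φ (diagonal a) * (diagonal g)ᵀ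

/-- `D₀⁻¹ A*` with `D₀ = Diag(n, n - 1, …, n - p + 1)`; with indices starting at `0`, the entry
`n - i + 1` becomes `n - i`. -/
noncomputable def bestEst (n : ℕ) {p : ℕ} (M : Matrix (Fin p) (Fin p) ℝ) :
    Matrix (Fin p) (Fin p) ℝ :=
  (diagonal fun i : Fin p => (n : ℝ) - i)⁻¹ * M

/-- The Cholesky (James–Stein) estimator `T D_S⁻¹ T'`, where `A = T T'` and
`D_S = Diag(n + p - 2 i + 1)`; with indices starting at `0`, the entry becomes `n + p - 2 i - 1`. -/
noncomputable def steinEst (n : ℕ) {p : ℕ} (A : Matrix (Fin p) (Fin p) ℝ) :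
    Matrix (Fin p) (Fin p) ℝ :=
  cholesky p A * (diagonal fun i : Fin p => (n : ℝ) + p - 2 * i - 1)⁻¹ * (cholesky p A)ᵀ

/-- The maximum likelihood estimator `A / n`. -/
noncomputable def mle (n : ℕ) {p : ℕ} (A : Matrix (Fin p) (Fin p) ℝ) :
    Matrix (Fin p) (Fin p) ℝ :=
  (n : ℝ)⁻¹ • A

/-- The chi-square distribution with `k` degrees of freedom. -/
noncomputable def chiSq (k : ℕ) : Measure ℝ := gammaMeasure ((k : ℝ) / 2) (1 / 2)

/-- The minimum risk `∑ᵢ {log(n - i + 1) - E log χ²_{n-i+1}}`, with indices starting at `0`. -/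
noncomputable def minRisk (n p : ℕ) : ℝ :=
  ∑ i : Fin p, (Real.log ((n : ℝ) - i) - ∫ x, Real.log x ∂(chiSq (n - i)))

end Iwasawa

/-! ### Pivots and the Cholesky factor -/

namespace Iwasawa

/-! Let K be the Cholesky factor of Σ. Then A is distributed as K W K' with W the Gram matrix of p
independent standard Gaussian vectors in ℝⁿ. The pivots of K W K' are those of Σ times those of W
(`pivots_conj`). Projecting successively onto orthogonal complements shows that the pivots of W are
independent χ² variables with n-i+1 degrees of freedom (`map_pivots_gram`). The data A* thus form p
independent scale families.

An invariant φ is determined by B = φ(1), since the diagonal group acts transitively. Taking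
expectations, its risk is the claimed minimum plus the Stein loss of B relative to D₀⁻¹
(`starRisk_invariant`). That loss is nonnegative and vanishes only at B = D₀⁻¹, which gives (a) and
(b).

For minimaxity, take Σ = Diag(l)⁻¹ with independent Gamma(e, 1) priors on the precisions. The prior
is conjugate, and the posterior expected loss of any estimate has a lower bound that does not
involve the observation (`le_lintegral_steinLoss_gamma`). The average risk, hence the supremum,
exceeds this bound, which tends to the minimum risk as e tends to 0 (`tendsto_bayes_risk`).

For (d), let c_j = n+p-2j+1 be the expected squared norm of column j of the Cholesky factor of W. If
the ratios c_j/d_j sum to p, the estimator T Diag(d)⁻¹ T' has constant risk ∑ (log d_i - E log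
χ²_{n-i+1}) (`risk_eq_choleskyEst`). This covers d = c and d = n, because the c_j average to n. The
inequalities follow from n-i+1 ≤ c_i and the concavity of the logarithm. -/

theorem pivots_eq_sq_cholesky : ∀ {p : ℕ} {M : Matrix (Fin p) (Fin p) ℝ}, M.PosDef →
    ∀ i, pivots p M i = cholesky p M i i ^ 2
  | 0, _, _ => fun i => i.elim0
  | p + 1, M, hM => by
    intro i
    refine Fin.cases ?_ (fun i => ?_) i
    · simp [pivots, cholesky, Real.sq_sqrt hM.diag_pos.le]
    · simpa [pivots, cholesky] using pivots_eq_sq_cholesky (schur_posDef hM) i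

theorem pivots_pos {p : ℕ} {M : Matrix (Fin p) (Fin p) ℝ} (hM : M.PosDef) (i : Fin p) :
    0 < pivots p M i := by
  rw [pivots_eq_sq_cholesky hM]
  exact pow_pos ((cholesky_spec p M hM).2.1 i) 2

/-- A lower triangular matrix with positive diagonal is the Cholesky factor of `T Tᵀ`. -/
theorem cholesky_mul_transpose : ∀ {p : ℕ} {T : Matrix (Fin p) (Fin p) ℝ},
    (∀ i j, i < j → T i j = 0) → (∀ i, 0 < T i i) → cholesky p (T * Tᵀ) = T
  | 0, _, _, _ => by ext i; exact i.elim0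
  | p + 1, T, h1, h2 => by
    have h0 := h2 0
    have hz : ∀ j : Fin p, T 0 j.succ = 0 := fun j => h1 _ _ (Fin.succ_pos j)
    have e0 : (T * Tᵀ) 0 0 = T 0 0 ^ 2 := by
      simp [mul_apply, Fin.sum_univ_succ, hz, sq]
    have e1 : ∀ i : Fin p, (T * Tᵀ) i.succ 0 = T i.succ 0 * T 0 0 := fun i => by
      simp [mul_apply, Fin.sum_univ_succ, hz]
    have e1' : ∀ i : Fin p, (T * Tᵀ) 0 i.succ = T i.succ 0 * T 0 0 := fun i => by
      simp [mul_apply, Fin.sum_univ_succ, hz, mul_comm]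
    -- The rank-one term removed by the Schur complement is exactly the contribution of the first
    -- column of T.
    have es : schur (T * Tᵀ) = T.submatrix Fin.succ Fin.succ * (T.submatrix Fin.succ Fin.succ)ᵀ := by
      ext i j
      simp only [schur, of_apply, e0, e1, e1']
      simp only [mul_apply, transpose_apply, Fin.sum_univ_succ, submatrix_apply]
      field_simp
      ring
    have ih := cholesky_mul_transpose (T := T.submatrix Fin.succ Fin.succ)
      (fun i j hij => h1 _ _ (Fin.succ_lt_succ_iff.2 hij)) (fun i => h2 _)
    ext i j
    have hs : Real.sqrt (T 0 0 ^ 2) = T 0 0 := Real.sqrt_sq h0.le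
    refine Fin.cases ?_ (fun i => ?_) i <;> refine Fin.cases ?_ (fun j => ?_) j
    · simp [cholesky, e0, hs]
    · simp [cholesky, hz]
    · simp [cholesky, e0, e1, hs, h0.ne']
    · simpa [cholesky, es] using congrFun (congrFun ih i) j

/-- Completing the square in the first coordinate leaves the quadratic form of the Schur complement.
When the trailing coordinates vanish, the square alone is positive. -/
theorem posDef_of_schur {p : ℕ} {M : Matrix (Fin (p + 1)) (Fin (p + 1)) ℝ} (hM : M.IsSymm)
    (h0 : 0 < M 0 0) (hS : (schur M).PosDef) : M.PosDef := by
  have hs : ∀ i j, M i j = M j i := fun i j => (hM.apply i j).symm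
  refine Matrix.PosDef.of_dotProduct_mulVec_pos ?_ ?_
  · ext i j
    simp [conjTranspose_apply, hs i j]
  intro x hx
  have key : star x ⬝ᵥ M *ᵥ x = M 0 0 * (x 0 + (∑ j : Fin p, M 0 j.succ * x j.succ) / M 0 0) ^ 2 +
      star (fun i : Fin p => x i.succ) ⬝ᵥ schur M *ᵥ (fun i : Fin p => x i.succ) := by
    have e1 : ∑ i : Fin p, x i.succ * (M i.succ 0 * x 0) =
        x 0 * ∑ j : Fin p, M 0 j.succ * x j.succ := by
      rw [Finset.mul_sum]
      refine Finset.sum_congr rfl fun i _ => ?_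
      rw [hs i.succ 0]; ring
    have e2 : ∑ i : Fin p, x i.succ * ∑ j : Fin p, M i.succ 0 * M 0 j.succ / M 0 0 * x j.succ
        = (∑ j : Fin p, M 0 j.succ * x j.succ) ^ 2 / M 0 0 := by
      rw [sq, Finset.sum_mul, Finset.sum_div]
      refine Finset.sum_congr rfl fun i _ => ?_
      rw [hs i.succ 0, Finset.mul_sum, Finset.mul_sum, Finset.sum_div]
      refine Finset.sum_congr rfl fun j _ => ?_
      ring
    simp only [dotProduct, mulVec, schur, of_apply, sub_mul, Finset.sum_sub_distrib, mul_sub,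
      star_trivial, Pi.star_apply, e2, Fin.sum_univ_succ, mul_add, Finset.sum_add_distrib, e1]
    field_simp
    ring
  rw [key]
  by_cases hy : (fun i : Fin p => x i.succ) = 0
  · have hy' : ∀ i : Fin p, x i.succ = 0 := fun i => congrFun hy i
    have hx0 : x 0 ≠ 0 := by
      intro h
      exact hx (funext fun i => Fin.cases h hy' i)
    rw [hy, mulVec_zero, dotProduct_zero, add_zero]
    simp only [hy', mul_zero, Finset.sum_const_zero, zero_div, add_zero]
    positivity
  · have := hS.dotProduct_mulVec_pos hy
    have h2 : 0 ≤ M 0 0 * (x 0 + (∑ j : Fin p, M 0 j.succ * x j.succ) / M 0 0) ^ 2 := by positivity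
    linarith

theorem schur_isSymm {p : ℕ} {M : Matrix (Fin (p + 1)) (Fin (p + 1)) ℝ} (hM : M.IsSymm) :
    (schur M).IsSymm := by
  ext i j
  simp only [schur, transpose_apply, of_apply, hM.apply i.succ j.succ, hM.apply 0 j.succ,
    hM.apply i.succ 0]
  ring

/-- Converse of `pivots_pos`. It yields almost sure definiteness of a Gram matrix from the law of
its pivots, without a separate linear independence argument. -/
theorem posDef_of_pivots_pos : ∀ {p : ℕ} {M : Matrix (Fin p) (Fin p) ℝ}, M.IsSymm →
    (∀ i, 0 < pivots p M i) → M.PosDef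
  | 0, M, _, _ => Matrix.PosDef.of_dotProduct_mulVec_pos (by ext i; exact i.elim0)
      fun x hx => absurd (Subsingleton.elim x 0) hx
  | p + 1, M, hM, h => posDef_of_schur hM (by simpa [pivots] using h 0)
      (posDef_of_pivots_pos (schur_isSymm hM) fun i => by simpa [pivots] using h i.succ)

/-! ### Equivariance under lower triangular matrices -/

section LowerTriangular

variable {p : ℕ} {K : Matrix (Fin p) (Fin p) ℝ}

theorem lower_mul_apply_eq_zero {T : Matrix (Fin p) (Fin p) ℝ} (hK : ∀ i j, i < j → K i j = 0)
    (hT : ∀ i j, i < j → T i j = 0) {i j : Fin p} (hij : i < j) : (K * T) i j = 0 := by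
  rw [mul_apply]
  refine Finset.sum_eq_zero fun k _ => ?_
  rcases lt_or_ge i k with h | h
  · simp [hK i k h]
  · simp [hT k j (h.trans_lt hij)]

theorem lower_mul_diag {T : Matrix (Fin p) (Fin p) ℝ} (hK : ∀ i j, i < j → K i j = 0)
    (hT : ∀ i j, i < j → T i j = 0) (i : Fin p) : (K * T) i i = K i i * T i i := by
  rw [mul_apply]
  refine Finset.sum_eq_single i (fun k _ hk => ?_) (by simp)
  rcases lt_or_gt_of_ne hk with h | h
  · simp [hT k i h]
  · simp [hK i k h]

theorem lower_det (hK : ∀ i j, i < j → K i j = 0) : K.det = ∏ i, K i i :=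
  det_of_isLowerTriangular K fun i j hij => hK i j hij

theorem lower_isUnit_det (hK : ∀ i j, i < j → K i j = 0) (hK' : ∀ i, 0 < K i i) :
    IsUnit K.det := by
  rw [lower_det hK]
  exact (Finset.prod_pos fun i _ => hK' i).ne'.isUnit

/-- Uniqueness of the Cholesky factor: if W = T T', then K T is lower triangular with positive
diagonal and (K T)(K T)' = K W K'. -/
theorem cholesky_conj (hK : ∀ i j, i < j → K i j = 0) (hK' : ∀ i, 0 < K i i)
    {W : Matrix (Fin p) (Fin p) ℝ} (hW : W.PosDef) :
    cholesky p (K * W * Kᵀ) = K * cholesky p W := by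
  obtain ⟨h1, h2, h3⟩ := cholesky_spec p W hW
  have : K * W * Kᵀ = (K * cholesky p W) * (K * cholesky p W)ᵀ := by
    conv_lhs => rw [← h3]
    simp only [transpose_mul, Matrix.mul_assoc]
  rw [this, cholesky_mul_transpose]
  · exact fun i j hij => lower_mul_apply_eq_zero hK h1 hij
  · intro i
    rw [lower_mul_diag hK h1]
    exact mul_pos (hK' i) (h2 i)

theorem posDef_conj (hK : IsUnit K.det) {W : Matrix (Fin p) (Fin p) ℝ} (hW : W.PosDef) :
    (K * W * Kᵀ).PosDef := by
  have h := (Matrix.isUnit_iff_isUnit_det K).2 hK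
  have := hW.mul_mul_conjTranspose_same (B := K) (Matrix.vecMul_injective_iff_isUnit.2 h)
  simpa using this

theorem pivots_conj (hK : ∀ i j, i < j → K i j = 0) (hK' : ∀ i, 0 < K i i)
    {W : Matrix (Fin p) (Fin p) ℝ} (hW : W.PosDef) (i : Fin p) :
    pivots p (K * W * Kᵀ) i = K i i ^ 2 * pivots p W i := by
  rw [pivots_eq_sq_cholesky (posDef_conj (lower_isUnit_det hK hK') hW), pivots_eq_sq_cholesky hW,
    cholesky_conj hK hK' hW, lower_mul_diag hK (cholesky_spec p W hW).1]
  ring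

end LowerTriangular

/-! ### The Stein loss -/

theorem det_eq_prod_pivots {p : ℕ} {M : Matrix (Fin p) (Fin p) ℝ} (hM : M.PosDef) :
    M.det = ∏ i, pivots p M i := by
  obtain ⟨h1, h2, h3⟩ := cholesky_spec p M hM
  conv_lhs => rw [← h3]
  rw [det_mul, det_transpose, lower_det h1, ← Finset.prod_mul_distrib]
  exact Finset.prod_congr rfl fun i _ => by rw [pivots_eq_sq_cholesky hM, sq]

theorem log_det_eq_sum {p : ℕ} {M : Matrix (Fin p) (Fin p) ℝ} (hM : M.PosDef) :
    Real.log M.det = ∑ i, Real.log (pivots p M i) := by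
  rw [det_eq_prod_pivots hM, Real.log_prod fun i _ => (pivots_pos hM i).ne']

theorem trace_eq_sum_sq_cholesky {p : ℕ} {M : Matrix (Fin p) (Fin p) ℝ} (hM : M.PosDef) :
    M.trace = ∑ i, ∑ j, cholesky p M i j ^ 2 := by
  conv_lhs => rw [← (cholesky_spec p M hM).2.2]
  simp [trace, mul_apply, sq]

/-- The matrices whose trace and determinant enter the two losses are similar through K'. -/
theorem steinLoss_conj {p : ℕ} {K : Matrix (Fin p) (Fin p) ℝ} (hK : IsUnit K.det)
    (M N : Matrix (Fin p) (Fin p) ℝ) :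
    steinLoss (K * M * Kᵀ) (K * N * Kᵀ) = steinLoss M N := by
  have hKT : IsUnit Kᵀ.det := by rwa [det_transpose]
  have e : (K * N * Kᵀ)⁻¹ * (K * M * Kᵀ) = (Kᵀ)⁻¹ * (N⁻¹ * M) * Kᵀ := by
    rw [Matrix.mul_inv_rev, Matrix.mul_inv_rev]
    simp only [Matrix.mul_assoc]
    rw [← Matrix.mul_assoc K⁻¹ K, Matrix.nonsing_inv_mul K hK, Matrix.one_mul]
  have et : ((Kᵀ)⁻¹ * (N⁻¹ * M) * Kᵀ).trace = (N⁻¹ * M).trace := by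
    rw [trace_mul_comm, ← Matrix.mul_assoc, Matrix.mul_nonsing_inv _ hKT, Matrix.one_mul]
  have ed : ((Kᵀ)⁻¹ * (N⁻¹ * M) * Kᵀ).det = (N⁻¹ * M).det := by
    rw [det_mul_comm, ← Matrix.mul_assoc, Matrix.mul_nonsing_inv _ hKT, Matrix.one_mul]
  rw [steinLoss, steinLoss, e, et, ed]

theorem steinLoss_one {p : ℕ} (M : Matrix (Fin p) (Fin p) ℝ) :
    steinLoss M 1 = M.trace - Real.log M.det - p := by
  simp [steinLoss]

/-- The trace is the sum of the squared Cholesky entries and the determinant is the product of the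
pivots. Every summand is nonnegative, so nonnegativity of the loss and its equality case need no
eigenvalues. -/
theorem steinLoss_one_eq_sum {p : ℕ} {M : Matrix (Fin p) (Fin p) ℝ} (hM : M.PosDef) :
    steinLoss M 1 = ∑ i, (pivots p M i - Real.log (pivots p M i) - 1) +
      ∑ i, ∑ j ∈ Finset.univ.erase i, cholesky p M i j ^ 2 := by
  rw [steinLoss_one, trace_eq_sum_sq_cholesky hM, log_det_eq_sum hM]
  have : ∀ i, ∑ j, cholesky p M i j ^ 2 = pivots p M i +
      ∑ j ∈ Finset.univ.erase i, cholesky p M i j ^ 2 := fun i => by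
    rw [pivots_eq_sq_cholesky hM]
    exact (Finset.add_sum_erase _ (fun j => cholesky p M i j ^ 2) (Finset.mem_univ i)).symm
  simp only [this, Finset.sum_add_distrib, Finset.sum_sub_distrib]
  simp
  ring

theorem sub_log_sub_one_nonneg {x : ℝ} (hx : 0 < x) : 0 ≤ x - Real.log x - 1 := by
  linarith [Real.log_le_sub_one_of_pos hx]

theorem steinLoss_one_nonneg {p : ℕ} {M : Matrix (Fin p) (Fin p) ℝ} (hM : M.PosDef) :
    0 ≤ steinLoss M 1 := by
  rw [steinLoss_one_eq_sum hM]
  exact add_nonneg (Finset.sum_nonneg fun i _ => sub_log_sub_one_nonneg (pivots_pos hM i))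
    (Finset.sum_nonneg fun i _ => Finset.sum_nonneg fun j _ => sq_nonneg _)

theorem eq_one_of_steinLoss_one {p : ℕ} {M : Matrix (Fin p) (Fin p) ℝ} (hM : M.PosDef)
    (h : steinLoss M 1 = 0) : M = 1 := by
  have hA : ∀ i ∈ Finset.univ, 0 ≤ pivots p M i - Real.log (pivots p M i) - 1 :=
    fun i _ => sub_log_sub_one_nonneg (pivots_pos hM i)
  have hB : ∀ i ∈ Finset.univ, 0 ≤ ∑ j ∈ Finset.univ.erase i, cholesky p M i j ^ 2 :=
    fun i _ => Finset.sum_nonneg fun j _ => sq_nonneg _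
  rw [steinLoss_one_eq_sum hM, add_eq_zero_iff_of_nonneg (Finset.sum_nonneg hA)
    (Finset.sum_nonneg hB), Finset.sum_eq_zero_iff_of_nonneg hA,
    Finset.sum_eq_zero_iff_of_nonneg hB] at h
  obtain ⟨h1, h2, h3⟩ := cholesky_spec p M hM
  have hT : cholesky p M = 1 := by
    ext i j
    by_cases hij : i = j
    · subst hij
      have hi := h.1 i (Finset.mem_univ _)
      have : pivots p M i = 1 := by
        by_contra hne
        linarith [Real.log_lt_sub_one_of_pos (pivots_pos hM i) hne]
      rw [pivots_eq_sq_cholesky hM] at this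
      rw [one_apply_eq]
      nlinarith [h2 i]
    · have hi := h.2 i (Finset.mem_univ _)
      rw [Finset.sum_eq_zero_iff_of_nonneg fun _ _ => sq_nonneg _] at hi
      rw [one_apply_ne hij]
      exact pow_eq_zero_iff (two_ne_zero) |>.1
        (hi j (Finset.mem_erase.2 ⟨Ne.symm hij, Finset.mem_univ _⟩))
  rw [← h3, hT]
  simp

/-- Together with `steinLoss_conj` this transports facts about the loss relative to the identity to
an arbitrary S. -/
theorem exists_eq_conj_of_posDef {p : ℕ} {S M : Matrix (Fin p) (Fin p) ℝ} (hS : S.PosDef)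
    (hM : M.PosDef) : ∃ K N : Matrix (Fin p) (Fin p) ℝ, IsUnit K.det ∧ N.PosDef ∧
      S = K * 1 * Kᵀ ∧ M = K * N * Kᵀ := by
  obtain ⟨h1, h2, h3⟩ := cholesky_spec p S hS
  have hu := lower_isUnit_det h1 h2
  have hut : IsUnit (cholesky p S)ᵀ.det := by rwa [det_transpose]
  refine ⟨cholesky p S, (cholesky p S)⁻¹ * M * ((cholesky p S)⁻¹)ᵀ, hu,
    posDef_conj (by simpa using hu) hM, by rw [Matrix.mul_one, h3], ?_⟩
  rw [transpose_nonsing_inv]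
  simp only [Matrix.mul_assoc]
  rw [Matrix.nonsing_inv_mul _ hut, Matrix.mul_one, ← Matrix.mul_assoc,
    Matrix.mul_nonsing_inv _ hu, Matrix.one_mul]

theorem steinLoss_nonneg {p : ℕ} {M S : Matrix (Fin p) (Fin p) ℝ} (hM : M.PosDef)
    (hS : S.PosDef) : 0 ≤ steinLoss M S := by
  obtain ⟨K, N, hK, hN, rfl, rfl⟩ := exists_eq_conj_of_posDef hS hM
  rw [steinLoss_conj hK]
  exact steinLoss_one_nonneg hN

theorem eq_of_steinLoss_eq_zero {p : ℕ} {M S : Matrix (Fin p) (Fin p) ℝ} (hM : M.PosDef)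
    (hS : S.PosDef) (h : steinLoss M S = 0) : M = S := by
  obtain ⟨K, N, hK, hN, rfl, rfl⟩ := exists_eq_conj_of_posDef hS hM
  rw [steinLoss_conj hK] at h
  rw [eq_one_of_steinLoss_one hN h]

/-- The Stein loss with respect to a diagonal matrix `Diag(λ)⁻¹`. -/
theorem steinLoss_diagonal_inv {p : ℕ} {M : Matrix (Fin p) (Fin p) ℝ} (hM : M.PosDef)
    {l : Fin p → ℝ} (hl : ∀ i, 0 < l i) :
    steinLoss M (diagonal fun i => (l i)⁻¹) =
      ∑ i, l i * M i i - Real.log M.det - ∑ i, Real.log (l i) - p := by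
  have e : (diagonal fun i => (l i)⁻¹)⁻¹ = diagonal l := by
    refine Matrix.inv_eq_right_inv ?_
    rw [diagonal_mul_diagonal]
    simp only [inv_mul_cancel₀ (hl _).ne', diagonal_one]
  rw [steinLoss, e, det_mul, det_diagonal, Real.log_mul
    (Finset.prod_pos fun i _ => hl i).ne' hM.det_pos.ne', Real.log_prod fun i _ => (hl i).ne']
  simp [trace, diagonal_mul]
  ring

/-! ### Measurability of matrix functions -/

section Measurability

variable {α : Type*} [MeasurableSpace α]

theorem measurable_schur {p : ℕ} {M : α → Matrix (Fin (p + 1)) (Fin (p + 1)) ℝ}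
    (hM : ∀ i j, Measurable fun a => M a i j) (i j : Fin p) :
    Measurable fun a => schur (M a) i j := by
  have h1 := hM i.succ j.succ
  have h2 := hM i.succ 0
  have h3 := hM 0 j.succ
  have h4 := hM 0 0
  simp only [schur, of_apply]
  fun_prop

theorem measurable_pivots : ∀ {p : ℕ} {M : α → Matrix (Fin p) (Fin p) ℝ},
    (∀ i j, Measurable fun a => M a i j) → ∀ i, Measurable fun a => pivots p (M a) i
  | 0, _, _ => fun i => i.elim0
  | p + 1, M, hM => by
    intro i
    refine Fin.cases ?_ (fun i => ?_) i
    · simpa [pivots] using hM 0 0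
    · simpa [pivots] using measurable_pivots (measurable_schur hM) i

theorem measurable_cholesky : ∀ {p : ℕ} {M : α → Matrix (Fin p) (Fin p) ℝ},
    (∀ i j, Measurable fun a => M a i j) → ∀ i j, Measurable fun a => cholesky p (M a) i j
  | 0, _, _ => fun i => i.elim0
  | p + 1, M, hM => by
    intro i j
    have h00 := hM 0 0
    refine Fin.cases ?_ (fun i => ?_) i <;> refine Fin.cases ?_ (fun j => ?_) j
    · simp only [cholesky, of_apply, cons_val_zero]
      fun_prop
    · simp [cholesky]
    · have := hM i.succ 0
      simp only [cholesky, of_apply, cons_val_zero, cons_val_succ]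
      fun_prop
    · simpa [cholesky] using measurable_cholesky (measurable_schur hM) i j

theorem measurable_det {p : ℕ} {M : α → Matrix (Fin p) (Fin p) ℝ}
    (hM : ∀ i j, Measurable fun a => M a i j) : Measurable fun a => (M a).det := by
  simp only [det_apply]
  refine Finset.measurable_sum _ fun σ _ => Measurable.const_smul ?_ _
  exact Finset.measurable_prod _ fun i _ => hM _ _

end Measurability

/-! ### Gamma laws -/

section Gamma

open Set Filter Topology

variable {a r : ℝ}

theorem toReal_gammaPDF (ha : 0 < a) (hr : 0 < r) (x : ℝ) :
    (gammaPDF a r x).toReal =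
      (Ici 0).indicator (fun x => r ^ a / Real.Gamma a * (x ^ (a - 1) * Real.exp (-(r * x)))) x := by
  rw [gammaPDF, ENNReal.toReal_ofReal (gammaPDFReal_nonneg ha hr x), gammaPDFReal]
  by_cases hx : 0 ≤ x
  · rw [if_pos hx, indicator_of_mem (mem_Ici.2 hx), mul_assoc]
  · rw [if_neg hx, indicator_of_notMem (by simpa using hx)]

theorem gammaPDF_const_pos (ha : 0 < a) (hr : 0 < r) : 0 < r ^ a / Real.Gamma a :=
  div_pos (Real.rpow_pos_of_pos hr a) (Real.Gamma_pos_of_pos ha)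

theorem measurable_gammaPDF (a r : ℝ) : Measurable (gammaPDF a r) :=
  (measurable_gammaPDFReal a r).ennreal_ofReal

theorem integrable_gammaMeasure_iff (ha : 0 < a) (hr : 0 < r) {f : ℝ → ℝ} :
    Integrable f (gammaMeasure a r) ↔
      IntegrableOn (fun x => x ^ (a - 1) * Real.exp (-(r * x)) * f x) (Ioi 0) := by
  rw [gammaMeasure, integrable_withDensity_iff_integrable_smul' (measurable_gammaPDF a r)
    (ae_of_all _ fun x => by simp [gammaPDF]), ← integrableOn_Ici_iff_integrableOn_Ioi,
    ← integrable_indicator_iff measurableSet_Ici]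
  refine Iff.trans (integrable_congr (ae_of_all _ fun x => ?_))
    (integrable_const_mul_iff (gammaPDF_const_pos ha hr).ne'.isUnit _)
  simp only [toReal_gammaPDF ha hr, smul_eq_mul, indicator]
  split_ifs <;> ring

theorem integral_gammaMeasure (ha : 0 < a) (hr : 0 < r) (f : ℝ → ℝ) :
    ∫ x, f x ∂(gammaMeasure a r) = r ^ a / Real.Gamma a *
      ∫ x in Ioi 0, x ^ (a - 1) * Real.exp (-(r * x)) * f x := by
  rw [gammaMeasure, integral_withDensity_eq_integral_toReal_smul (measurable_gammaPDF a r)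
    (ae_of_all _ fun x => by simp [gammaPDF]), ← integral_Ici_eq_integral_Ioi,
    ← integral_indicator measurableSet_Ici, ← integral_const_mul]
  refine integral_congr_ae (ae_of_all _ fun x => ?_)
  simp only [toReal_gammaPDF ha hr, smul_eq_mul, indicator]
  split_ifs <;> ring

theorem integrableOn_rpow_mul_exp (ha : 0 < a) (hr : 0 < r) :
    IntegrableOn (fun x : ℝ => x ^ (a - 1) * Real.exp (-(r * x))) (Ioi 0) := by
  refine Integrable.of_integral_ne_zero ?_
  rw [Real.integral_rpow_mul_exp_neg_mul_Ioi ha hr]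
  have := Real.Gamma_pos_of_pos ha
  positivity

/-- For r ≤ 0 the exponential is at least 1, and no power of x is integrable on the whole half line.
-/
theorem not_integrableOn_rpow_mul_exp (hr : r ≤ 0) :
    ¬ IntegrableOn (fun x : ℝ => x ^ (a - 1) * Real.exp (-(r * x))) (Ioi 0) := by
  intro h
  refine not_integrableOn_Ioi_rpow (a - 1) (Integrable.mono' h
    (by fun_prop) ((ae_restrict_iff' measurableSet_Ioi).2 (ae_of_all _ fun x hx => ?_)))
  have hx : 0 < x := hx
  rw [Real.norm_of_nonneg (by positivity)]
  refine le_mul_of_one_le_right (by positivity) (Real.one_le_exp ?_)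
  nlinarith

theorem integrable_exp_gammaMeasure_iff (ha : 0 < a) (hr : 0 < r) (t : ℝ) :
    Integrable (fun x => Real.exp (t * x)) (gammaMeasure a r) ↔ t < r := by
  have e : (fun x : ℝ => x ^ (a - 1) * Real.exp (-(r * x)) * Real.exp (t * x)) =
      fun x : ℝ => x ^ (a - 1) * Real.exp (-((r - t) * x)) := by
    funext x
    rw [mul_assoc, ← Real.exp_add]
    ring_nf
  rw [integrable_gammaMeasure_iff ha hr, e]
  refine ⟨fun h => ?_, fun h => integrableOn_rpow_mul_exp ha (sub_pos.2 h)⟩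
  by_contra hn
  exact not_integrableOn_rpow_mul_exp (by linarith) h

/-- Exponential tilting changes the rate to r - t. For t ≥ r the exponential is not integrable and
`mgf` takes its default value 0. -/
theorem mgf_gammaMeasure (ha : 0 < a) (hr : 0 < r) (t : ℝ) :
    mgf id (gammaMeasure a r) t = if t < r then (r / (r - t)) ^ a else 0 := by
  split_ifs with h
  · have h' := sub_pos.2 h
    simp only [mgf, id, integral_gammaMeasure ha hr, mul_assoc, ← Real.exp_add]
    have e : ∀ x : ℝ, -(r * x) + t * x = -((r - t) * x) := fun x => by ring
    simp only [e]
    rw [Real.integral_rpow_mul_exp_neg_mul_Ioi ha h', Real.div_rpow hr.le h'.le,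
      Real.div_rpow zero_le_one h'.le, Real.one_rpow]
    have := (Real.Gamma_pos_of_pos ha).ne'
    field_simp
  · exact mgf_undef (by simpa [integrable_exp_gammaMeasure_iff ha hr] using not_lt.1 h)

/-- A moment generating function is positive wherever the exponential is integrable, so the default
value 0 reveals the integrability set. That set is a neighbourhood of 0; hence the complex
transforms agree on the imaginary axis, that is, the characteristic functions agree. -/
theorem eq_gammaMeasure_of_mgf (ha : 0 < a) (hr : 0 < r) {μ : Measure ℝ} [IsProbabilityMeasure μ]
    (h : ∀ t, mgf id μ t = if t < r then (r / (r - t)) ^ a else 0) : μ = gammaMeasure a r := by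
  have := isProbabilityMeasure_gammaMeasure ha hr
  have hm : mgf id μ = mgf id (gammaMeasure a r) :=
    funext fun t => (h t).trans (mgf_gammaMeasure ha hr t).symm
  have he := eqOn_complexMGF_of_mgf hm
  have hs : integrableExpSet id μ = Iio r := by
    ext t
    by_cases ht : t < r
    · simp only [mem_Iio, ht, iff_true]
      by_contra hn
      have h0 : mgf id μ t = 0 := mgf_undef hn
      rw [h t, if_pos ht] at h0
      exact (Real.rpow_pos_of_pos (div_pos hr (sub_pos.2 ht)) a).ne' h0
    · simp only [mem_Iio, ht, iff_false]
      intro hi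
      have h0 : 0 < mgf id μ t := mgf_pos hi
      rw [h t, if_neg ht] at h0
      exact h0.false
  refine Measure.ext_of_charFun (funext fun t => ?_)
  rw [← complexMGF_id_mul_I, ← complexMGF_id_mul_I]
  refine he ?_
  simp [hs, hr]

theorem map_mul_gammaMeasure (ha : 0 < a) (hr : 0 < r) {c : ℝ} (hc : 0 < c) :
    (gammaMeasure a r).map (fun x => c * x) = gammaMeasure a (r / c) := by
  have := isProbabilityMeasure_gammaMeasure ha hr
  have : IsProbabilityMeasure ((gammaMeasure a r).map (fun x => c * x)) :=
    Measure.isProbabilityMeasure_map (by fun_prop)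
  refine eq_gammaMeasure_of_mgf ha (div_pos hr hc) fun t => ?_
  have e : mgf id ((gammaMeasure a r).map (fun x => c * x)) t = mgf id (gammaMeasure a r) (t * c) := by
    rw [mgf_id_map (by fun_prop)]
    simp only [mgf, id, mul_assoc]
  rw [e, mgf_gammaMeasure ha hr]
  simp only [lt_div_iff₀ hc]
  congr 1
  congr 1
  field_simp

theorem integrable_id_gammaMeasure (ha : 0 < a) (hr : 0 < r) :
    Integrable (fun x => x) (gammaMeasure a r) := by
  rw [integrable_gammaMeasure_iff ha hr]
  refine (integrableOn_rpow_mul_exp (by linarith : 0 < a + 1) hr).congr_fun (fun x hx => ?_)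
    measurableSet_Ioi
  have : x ^ (a + 1 - 1) = x ^ (a - 1) * x := by
    rw [← Real.rpow_add_one (ne_of_gt hx)]
    ring_nf
  simp only [this]
  ring

theorem integral_id_gammaMeasure (ha : 0 < a) (hr : 0 < r) :
    ∫ x, x ∂(gammaMeasure a r) = a / r := by
  have e : ∫ x in Ioi (0 : ℝ), x ^ (a - 1) * Real.exp (-(r * x)) * x =
      ∫ x in Ioi (0 : ℝ), x ^ (a + 1 - 1) * Real.exp (-(r * x)) := by
    refine setIntegral_congr_fun measurableSet_Ioi fun x hx => ?_
    have : x ^ (a + 1 - 1) = x ^ (a - 1) * x := by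
      rw [← Real.rpow_add_one (ne_of_gt hx)]
      ring_nf
    simp only [this]
    ring
  rw [integral_gammaMeasure ha hr, e, Real.integral_rpow_mul_exp_neg_mul_Ioi (by linarith) hr,
    Real.Gamma_add_one ha.ne', Real.rpow_add_one (by positivity), Real.div_rpow zero_le_one hr.le,
    Real.one_rpow]
  have := (Real.Gamma_pos_of_pos ha).ne'
  field_simp

theorem ae_pos_gammaMeasure (a r : ℝ) : ∀ᵐ x ∂(gammaMeasure a r), 0 < x := by
  rw [gammaMeasure, ae_withDensity_iff (measurable_gammaPDF a r)]
  filter_upwards [Measure.ae_ne volume (0 : ℝ)] with x hx h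
  by_contra hn
  exact h (gammaPDF_of_neg (lt_of_le_of_ne (not_lt.1 hn) hx))

theorem abs_log_le_rpow_add {x d : ℝ} (hx : 0 < x) (hd : 0 < d) :
    |Real.log x| ≤ (x ^ d + x ^ (-d)) / d := by
  have h1 := Real.log_le_rpow_div hx.le hd
  have h2 := Real.log_le_rpow_div (inv_pos.2 hx).le hd
  rw [Real.log_inv, Real.inv_rpow hx.le, ← Real.rpow_neg hx.le] at h2
  have h3 : 0 ≤ x ^ d / d := by positivity
  have h4 : 0 ≤ x ^ (-d) / d := by positivity
  rw [add_div, abs_le]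
  constructor <;> linarith

theorem integrableOn_rpow_mul_exp_mul_log (ha : 0 < a) (hr : 0 < r) :
    IntegrableOn (fun x : ℝ => x ^ (a - 1) * Real.exp (-(r * x)) * Real.log x) (Ioi 0) := by
  -- The logarithm is bounded with exponent d = a / 2, which keeps both shapes a ± a / 2 positive.
  have h1 := (integrableOn_rpow_mul_exp (by linarith : 0 < a + a / 2) hr)
  have h2 := (integrableOn_rpow_mul_exp (by linarith : 0 < a - a / 2) hr)
  refine Integrable.mono' ((h1.add h2).div_const (a / 2)) (by fun_prop)
    ((ae_restrict_iff' measurableSet_Ioi).2 (ae_of_all _ fun x hx => ?_))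
  have hx : 0 < x := hx
  have e1 : x ^ (a + a / 2 - 1) = x ^ (a - 1) * x ^ (a / 2) := by
    rw [← Real.rpow_add hx]; ring_nf
  have e2 : x ^ (a - a / 2 - 1) = x ^ (a - 1) * x ^ (-(a / 2)) := by
    rw [← Real.rpow_add hx]; ring_nf
  rw [norm_mul, Real.norm_of_nonneg (by positivity), Real.norm_eq_abs]
  refine (mul_le_mul_of_nonneg_left (abs_log_le_rpow_add hx (half_pos ha)) (by positivity)).trans
    (le_of_eq ?_)
  simp only [Pi.add_apply, e1, e2]
  ring

theorem integrable_log_gammaMeasure (ha : 0 < a) (hr : 0 < r) :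
    Integrable Real.log (gammaMeasure a r) :=
  (integrable_gammaMeasure_iff ha hr).2 (integrableOn_rpow_mul_exp_mul_log ha hr)

/-- A gamma variable of rate r is one of rate 1 divided by r. This isolates the rate, which is what
later removes the observation from the posterior bound. -/
theorem integral_log_gammaMeasure (ha : 0 < a) (hr : 0 < r) :
    ∫ x, Real.log x ∂(gammaMeasure a r) = ∫ x, Real.log x ∂(gammaMeasure a 1) - Real.log r := by
  have := isProbabilityMeasure_gammaMeasure ha one_pos
  have h := map_mul_gammaMeasure ha one_pos (inv_pos.2 hr)
  rw [one_div, inv_inv] at h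
  rw [← h, integral_map (by fun_prop) (by fun_prop)]
  rw [integral_congr_ae (g := fun x => Real.log x - Real.log r), integral_sub
    (integrable_log_gammaMeasure ha one_pos) (integrable_const _)]
  · simp
  · filter_upwards [ae_pos_gammaMeasure a 1] with x hx
    rw [Real.log_mul (inv_pos.2 hr).ne' hx.ne', Real.log_inv]
    ring

/-- Dominated convergence: for 0 < e ≤ 1 the power x^(a+e-1) is at most x^(a-1) + x^a, by comparing
exponents on either side of x = 1. One-sided continuity suffices, as e is a prior shape decreasing
to 0. -/
theorem tendsto_integral_log_gammaMeasure (ha : 0 < a) :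
    Tendsto (fun e => ∫ x, Real.log x ∂(gammaMeasure (a + e) 1)) (𝓝[>] 0)
      (𝓝 (∫ x, Real.log x ∂(gammaMeasure a 1))) := by
  have hI : Tendsto (fun e : ℝ => ∫ x in Ioi (0 : ℝ),
      x ^ (a + e - 1) * Real.exp (-(1 * x)) * Real.log x) (𝓝[>] 0)
      (𝓝 (∫ x in Ioi (0 : ℝ), x ^ (a - 1) * Real.exp (-(1 * x)) * Real.log x)) := by
    refine tendsto_integral_filter_of_dominated_convergence
      (fun x => |x ^ (a - 1) * Real.exp (-(1 * x)) * Real.log x| +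
        |x ^ (a + 1 - 1) * Real.exp (-(1 * x)) * Real.log x|) ?_ ?_ ?_ ?_
    · exact Eventually.of_forall fun e => by fun_prop
    · filter_upwards [Ioc_mem_nhdsGT (one_pos)] with e he
      refine (ae_restrict_iff' measurableSet_Ioi).2 (ae_of_all _ fun x hx => ?_)
      have hx : 0 < x := hx
      simp only [norm_mul, Real.norm_eq_abs, abs_mul, ← add_mul]
      refine mul_le_mul_of_nonneg_right (mul_le_mul_of_nonneg_right ?_ (abs_nonneg _))
        (abs_nonneg _)
      rw [abs_of_pos (by positivity), abs_of_pos (by positivity), abs_of_pos (by positivity)]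
      rcases le_total x 1 with h1 | h1
      · have := Real.rpow_le_rpow_of_exponent_ge hx h1 (by linarith [he.1] : a - 1 ≤ a + e - 1)
        have h2 : 0 ≤ x ^ (a + 1 - 1) := by positivity
        linarith
      · have := Real.rpow_le_rpow_of_exponent_le h1 (by linarith [he.2] : a + e - 1 ≤ a + 1 - 1)
        have h2 : 0 ≤ x ^ (a - 1) := by positivity
        linarith
    · exact (integrableOn_rpow_mul_exp_mul_log ha one_pos).abs.add
        (integrableOn_rpow_mul_exp_mul_log (by linarith) one_pos).abs
    · refine (ae_restrict_iff' measurableSet_Ioi).2 (ae_of_all _ fun x hx => ?_)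
      have hx : 0 < x := hx
      have hc : ContinuousAt (fun e : ℝ => x ^ (a + e - 1) * Real.exp (-(1 * x)) * Real.log x) 0 := by
        have : ContinuousAt (fun e : ℝ => x ^ (a + e - 1)) 0 :=
          ContinuousAt.rpow continuousAt_const (by fun_prop) (Or.inl hx.ne')
        exact (this.mul continuousAt_const).mul continuousAt_const
      have := hc.tendsto
      simp only [add_zero] at this
      exact this.mono_left nhdsWithin_le_nhds
  have hG : Tendsto (fun e : ℝ => (1 : ℝ) ^ (a + e) / Real.Gamma (a + e)) (𝓝[>] 0)
      (𝓝 ((1 : ℝ) ^ a / Real.Gamma a)) := by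
    simp only [Real.one_rpow]
    have hc : ContinuousAt (fun e : ℝ => Real.Gamma (a + e)) 0 := by
      refine ContinuousAt.comp (g := Real.Gamma) (f := fun e => a + e) ?_ (by fun_prop)
      refine (Real.differentiableAt_Gamma fun m => ?_).continuousAt
      have : (0 : ℝ) ≤ m := by positivity
      simp only [add_zero]
      linarith
    have := hc.tendsto
    simp only [add_zero] at this
    exact (tendsto_const_nhds.div this (Real.Gamma_pos_of_pos ha).ne').mono_left nhdsWithin_le_nhds
  rw [integral_gammaMeasure ha one_pos]
  refine (hG.mul hI).congr' ?_
  filter_upwards [self_mem_nhdsWithin] with e he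
  rw [integral_gammaMeasure (add_pos ha he) one_pos]

/-- The prior predictive density in the gamma model with a gamma prior. -/
noncomputable def predictivePDF (a e x : ℝ) : ℝ≥0∞ :=
  if 0 < x then ENNReal.ofReal ((1 / 2) ^ a * x ^ (a - 1) * Real.Gamma (a + e) /
    (Real.Gamma a * Real.Gamma e * (1 + x / 2) ^ (a + e))) else 0

/-- Bayes' formula for a gamma distributed rate parameter. -/
theorem gammaPDF_mul_gammaPDF {e : ℝ} (ha : 0 < a) (he : 0 < e) {l x : ℝ} (hl : l ≠ 0)
    (hx : x ≠ 0) : gammaPDF e 1 l * gammaPDF a (l / 2) x =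
      predictivePDF a e x * gammaPDF (a + e) (1 + x / 2) l := by
  -- Both sides vanish when l or x is negative. The axes are excluded because values there can
  -- disagree: with shape 1, `gammaPDF` is nonzero at 0 while `predictivePDF` is 0.
  rcases lt_or_gt_of_ne hl with hl | hl
  · rw [gammaPDF_of_neg hl, gammaPDF_of_neg hl]; simp
  rcases lt_or_gt_of_ne hx with hx | hx
  · rw [gammaPDF_of_neg hx, predictivePDF, if_neg hx.not_gt]; simp
  have h1 := Real.Gamma_pos_of_pos ha
  have h2 := Real.Gamma_pos_of_pos he
  have h3 := Real.Gamma_pos_of_pos (add_pos ha he)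
  rw [gammaPDF_of_nonneg hl.le, gammaPDF_of_nonneg hx.le, predictivePDF, if_pos hx,
    gammaPDF_of_nonneg hl.le, ← ENNReal.ofReal_mul (by positivity),
    ← ENNReal.ofReal_mul (by positivity)]
  congr 1
  have e1 : l ^ (a + e - 1) = l ^ a * l ^ (e - 1) := by
    rw [← Real.rpow_add hl]; ring_nf
  have e2 : Real.exp (-((1 + x / 2) * l)) = Real.exp (-(1 * l)) * Real.exp (-(l / 2 * x)) := by
    rw [← Real.exp_add]; ring_nf
  have e3 : (l / 2) ^ a = l ^ a * (1 / 2) ^ a := by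
    rw [← Real.mul_rpow hl.le (by norm_num)]; ring_nf
  have h4 : (0 : ℝ) < (1 + x / 2) ^ (a + e) := by positivity
  rw [e1, e2, e3, Real.one_rpow]
  field_simp

end Gamma

theorem isProbabilityMeasure_chiSq {k : ℕ} (hk : 0 < k) : IsProbabilityMeasure (chiSq k) :=
  isProbabilityMeasure_gammaMeasure (by positivity) (by norm_num)

theorem integrable_log_chiSq {k : ℕ} (hk : 0 < k) : Integrable Real.log (chiSq k) :=
  integrable_log_gammaMeasure (by positivity) (by norm_num)

/-! ### Gram matrices of standard Gaussian vectors -/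

section Gaussian

open scoped RealInnerProductSpace

/-- The exponents combine to -(1/2 - t) x². The value 0 for t ≥ 1/2 matches the default in
`mgf_gammaMeasure`. -/
theorem integral_exp_mul_sq_gaussianReal (t : ℝ) :
    ∫ x, Real.exp (t * x ^ 2) ∂(gaussianReal 0 1) =
      if t < 1 / 2 then Real.sqrt ((1 / 2) / (1 / 2 - t)) else 0 := by
  rw [integral_gaussianReal_eq_integral_smul one_ne_zero]
  have e : ∀ x : ℝ, gaussianPDFReal 0 1 x • Real.exp (t * x ^ 2) =
      (√(2 * Real.pi))⁻¹ * Real.exp (-(1 / 2 - t) * x ^ 2) := fun x => by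
    rw [gaussianPDFReal_def, smul_eq_mul]
    simp only [NNReal.coe_one, mul_one, sub_zero, mul_assoc, ← Real.exp_add]
    ring_nf
  simp only [e]
  rw [integral_const_mul, integral_gaussian]
  split_ifs with h
  · have h' : 0 < 1 / 2 - t := sub_pos.2 h
    rw [← Real.sqrt_inv, ← Real.sqrt_mul (by positivity)]
    congr 1
    have := Real.pi_pos.ne'
    field_simp
  · have h0 : √(Real.pi / (1 / 2 - t)) = 0 := Real.sqrt_eq_zero_of_nonpos
      (div_nonpos_of_nonneg_of_nonpos Real.pi_pos.le (by linarith))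
    rw [h0, mul_zero]

theorem indicator_univ_pi_vecCons {p : ℕ} {s : Fin (p + 1) → Set ℝ} (a : ℝ) (w : Fin p → ℝ) :
    (Set.univ.pi s).indicator (1 : (Fin (p + 1) → ℝ) → ℝ≥0∞) (vecCons a w) =
      (s 0).indicator 1 a * (Set.univ.pi fun i : Fin p => s i.succ).indicator 1 w := by
  have h : vecCons a w ∈ Set.univ.pi s ↔ a ∈ s 0 ∧ w ∈ Set.univ.pi fun i : Fin p => s i.succ := by
    rw [Set.mem_univ_pi, Set.mem_univ_pi]
    exact Fin.forall_fin_succ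
  by_cases h0 : vecCons a w ∈ Set.univ.pi s
  · rw [Set.indicator_of_mem h0, Set.indicator_of_mem (h.1 h0).1, Set.indicator_of_mem (h.1 h0).2]
    simp
  · rw [Set.indicator_of_notMem h0]
    by_cases h1 : a ∈ s 0
    · rw [Set.indicator_of_notMem fun h2 => h0 (h.2 ⟨h1, h2⟩), mul_zero]
    · rw [Set.indicator_of_notMem h1, zero_mul]

section Gram

variable {E : Type*} [NormedAddCommGroup E] [InnerProductSpace ℝ E]

theorem gram_vecCons_zero_zero {p : ℕ} (v : E) (y : Fin p → E) :
    gram ℝ (vecCons v y) 0 0 = ‖v‖ ^ 2 := by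
  simp

/-- The Schur complement of a Gram matrix is the Gram matrix of the projections onto the
orthogonal complement of the first vector. -/
theorem schur_gram_vecCons {p : ℕ} {v : E} (y : Fin p → E) :
    schur (gram ℝ (vecCons v y)) =
      gram ℝ fun i => (ℝ ∙ v)ᗮ.orthogonalProjectionOnto (y i) := by
  ext i j
  have h : (((ℝ ∙ v)ᗮ.orthogonalProjectionOnto (y i) : (ℝ ∙ v)ᗮ) : E) =
      y i - (⟪v, y i⟫ / ‖v‖ ^ 2) • v := by
    have h1 := (ℝ ∙ v).starProjection_orthogonal_val (y i)
    rw [← Submodule.starProjection_apply, h1, Submodule.starProjection_singleton]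
    simp
  refine Eq.trans ?_ (Submodule.inner_orthogonalProjectionOnto_eq_of_mem_left _ _).symm
  rw [h]
  simp only [schur, of_apply, gram_apply, cons_val_zero, cons_val_succ, inner_sub_left,
    real_inner_smul_left, real_inner_self_eq_norm_sq, real_inner_comm v]
  ring

theorem finrank_orthogonal_singleton [FiniteDimensional ℝ E] {v : E} (hv : v ≠ 0) :
    Module.finrank ℝ (ℝ ∙ v)ᗮ = Module.finrank ℝ E - 1 := by
  have := (ℝ ∙ v).finrank_add_finrank_orthogonal
  rw [finrank_span_singleton hv] at this
  omega

end Gram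

variable {E : Type*} [NormedAddCommGroup E] [InnerProductSpace ℝ E] [FiniteDimensional ℝ E]
  [MeasurableSpace E] [BorelSpace E]

/-- In an orthonormal basis exp(t‖x‖²) factors over the coordinates, so the moment generating
function is a power of the one-dimensional integral. Positive dimension makes that power 0 for t ≥
1/2. -/
theorem map_sq_norm_stdGaussian (hE : 0 < Module.finrank ℝ E) :
    (stdGaussian E).map (fun x => ‖x‖ ^ 2) = chiSq (Module.finrank ℝ E) := by
  have hn : (0 : ℝ) < Module.finrank ℝ E := by exact_mod_cast hE
  have : IsProbabilityMeasure ((stdGaussian E).map (fun x => ‖x‖ ^ 2)) :=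
    Measure.isProbabilityMeasure_map (by fun_prop)
  refine eq_gammaMeasure_of_mgf (by positivity) (by norm_num) fun t => ?_
  rw [mgf_id_map (by fun_prop), mgf, stdGaussian, integral_map (Measurable.aemeasurable (by fun_prop)) (by fun_prop)]
  have e : ∀ x : Fin (Module.finrank ℝ E) → ℝ,
      Real.exp (t * ‖∑ i, x i • stdOrthonormalBasis ℝ E i‖ ^ 2) =
        ∏ i, Real.exp (t * x i ^ 2) := fun x => by
    rw [← Real.exp_sum, ← Finset.mul_sum]
    congr 2
    rw [← real_inner_self_eq_norm_sq, (stdOrthonormalBasis ℝ E).orthonormal.inner_sum]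
    simp [sq]
  simp only [e]
  rw [integral_fintype_prod_eq_prod (fun _ x => Real.exp (t * x ^ 2))]
  simp only [integral_exp_mul_sq_gaussianReal, Finset.prod_const, Finset.card_univ,
    Fintype.card_fin]
  split_ifs with h
  · have h' : 0 < 1 / 2 - t := sub_pos.2 h
    rw [Real.sqrt_eq_rpow, ← Real.rpow_natCast, ← Real.rpow_mul (by positivity)]
    congr 1
    ring
  · exact zero_pow hE.ne'

theorem ae_ne_zero_stdGaussian (hE : 0 < Module.finrank ℝ E) :
    ∀ᵐ v ∂(stdGaussian E), v ≠ 0 := by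
  have h := ae_pos_gammaMeasure ((Module.finrank ℝ E : ℝ) / 2) (1 / 2)
  change ∀ᵐ x ∂(chiSq (Module.finrank ℝ E)), 0 < x at h
  rw [← map_sq_norm_stdGaussian hE] at h
  filter_upwards [ae_of_ae_map (by fun_prop) h] with v hv h0
  simp [h0] at hv

theorem integral_inner_sq_stdGaussian (v : E) :
    ∫ x, ⟪v, x⟫ ^ 2 ∂(stdGaussian E) = ‖v‖ ^ 2 := by
  have h := variance_dual_stdGaussian (innerSL ℝ v)
  rw [variance_of_integral_eq_zero (by fun_prop) (integral_strongDual_stdGaussian _)] at h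
  simpa using h

theorem integrable_inner_sq_stdGaussian (v : E) :
    Integrable (fun x => ⟪v, x⟫ ^ 2) (stdGaussian E) := by
  have : MemLp (fun x => innerSL ℝ v x) 2 (stdGaussian E) :=
    (innerSL ℝ v).comp_memLp' IsGaussian.memLp_two_id
  simpa using this.integrable_sq

/-- For t in K, the inner product of t with the projection of x equals that of t with x, so the
characteristic functions agree. This drives the inductions on dimension below. -/
theorem map_orthogonalProjectionOnto_stdGaussian (K : Submodule ℝ E) :
    (stdGaussian E).map K.orthogonalProjectionOnto = stdGaussian K := by
  have : IsProbabilityMeasure ((stdGaussian E).map K.orthogonalProjectionOnto) :=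
    Measure.isProbabilityMeasure_map (by fun_prop)
  refine Measure.ext_of_charFun (funext fun t => ?_)
  have h := charFun_stdGaussian (t : E)
  rw [charFun_apply] at h
  rw [charFun_stdGaussian, charFun_apply, integral_map (by fun_prop) (by fun_prop)]
  simpa only [K.inner_orthogonalProjectionOnto_eq_of_mem_right, Submodule.coe_norm] using h

theorem lintegral_pi_orthogonalProjectionOnto {p : ℕ} (K : Submodule ℝ E)
    {G : (Fin p → K) → ℝ≥0∞} (hG : Measurable G) :
    ∫⁻ y, G (fun i => K.orthogonalProjectionOnto (y i)) ∂(Measure.pi fun _ => stdGaussian E) =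
      ∫⁻ z, G z ∂(Measure.pi fun _ => stdGaussian K) := by
  have h : Measure.map (fun (y : Fin p → E) i => K.orthogonalProjectionOnto (y i))
      (Measure.pi fun _ => stdGaussian E) = Measure.pi fun _ => stdGaussian K := by
    have hK := map_orthogonalProjectionOnto_stdGaussian K
    have : IsProbabilityMeasure ((stdGaussian E).map K.orthogonalProjectionOnto) := by
      rw [hK]; infer_instance
    rw [Measure.pi_map_pi (f := fun _ : Fin p => K.orthogonalProjectionOnto)
      (fun _ => by fun_prop), hK]
  rw [← h, lintegral_map hG (by fun_prop)]

theorem lintegral_pi_vecCons {p : ℕ} {α : Type*} [MeasurableSpace α] (μ : Measure α) [SigmaFinite μ]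
    {F : (Fin (p + 1) → α) → ℝ≥0∞} (hF : Measurable F) :
    ∫⁻ x, F x ∂(Measure.pi fun _ => μ) =
      ∫⁻ v, ∫⁻ y, F (vecCons v y) ∂(Measure.pi fun _ => μ) ∂μ := by
  have h := (measurePreserving_piFinSuccAbove (fun _ : Fin (p + 1) => μ) 0).symm
  rw [← h.lintegral_comp hF, lintegral_prod (fun a => F
    ((MeasurableEquiv.piFinSuccAbove (fun _ => α) 0).symm a))
    (hF.comp (MeasurableEquiv.measurable _)).aemeasurable]
  refine lintegral_congr fun v => lintegral_congr fun y => congrArg F (funext fun i => ?_)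
  refine Fin.cases ?_ (fun i => ?_) i <;> simp [MeasurableEquiv.piFinSuccAbove]

theorem measurable_gram {p : ℕ} (i j : Fin p) :
    Measurable fun x : Fin p → E => gram ℝ x i j := by
  simp only [gram_apply]
  fun_prop

theorem measurable_pivots_gram (p : ℕ) :
    Measurable fun x : Fin p → E => pivots p (gram ℝ x) :=
  measurable_pi_iff.2 (measurable_pivots measurable_gram)

/-- The pivots of a Wishart matrix are independent chi-square variables. -/
theorem map_pivots_gram : ∀ (p : ℕ) (E : Type) [NormedAddCommGroup E] [InnerProductSpace ℝ E]
    [FiniteDimensional ℝ E] [MeasurableSpace E] [BorelSpace E], p ≤ Module.finrank ℝ E →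
    (Measure.pi fun _ : Fin p => stdGaussian E).map (fun x => pivots p (gram ℝ x)) =
      Measure.pi fun i : Fin p => chiSq (Module.finrank ℝ E - i)
  | 0, E, _, _, _, _, _, _ => by
    rw [Measure.pi_of_empty, Measure.pi_of_empty, Measure.map_dirac' (measurable_pivots_gram 0)]
    exact congrArg _ (Subsingleton.elim _ _)
  | p + 1, E, _, _, _, _, _, hp => by
    have hE : 0 < Module.finrank ℝ E := by omega
    have : ∀ i : Fin (p + 1), IsProbabilityMeasure (chiSq (Module.finrank ℝ E - i)) :=
      fun i => isProbabilityMeasure_chiSq (by omega)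
    refine (Measure.pi_eq fun s hs => ?_).symm
    have hs' := MeasurableSet.univ_pi hs
    rw [← lintegral_indicator_one hs', lintegral_map (measurable_one.indicator hs')
      (measurable_pivots_gram _), lintegral_pi_vecCons _
      (F := fun x => (Set.univ.pi s).indicator 1 (pivots (p + 1) (gram ℝ x)))
      ((measurable_one.indicator hs').comp (measurable_pivots_gram _))]
    -- Given v ≠ 0, the later pivots are those of the projections onto the complement of v. These
    -- are standard Gaussian in one dimension less, so the conditional law of the later pivots is
    -- free of v, whence independence.
    have hin : ∀ᵐ v ∂(stdGaussian E), ∫⁻ y : Fin p → E, (Set.univ.pi s).indicator 1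
        (pivots (p + 1) (gram ℝ (vecCons v y))) ∂(Measure.pi fun _ => stdGaussian E) =
        (s 0).indicator 1 (‖v‖ ^ 2) *
          ∏ i : Fin p, chiSq (Module.finrank ℝ E - (i.succ : Fin (p + 1))) (s i.succ) := by
      filter_upwards [ae_ne_zero_stdGaussian hE] with v hv
      have ht : MeasurableSet (Set.univ.pi fun i : Fin p => s i.succ) :=
        MeasurableSet.univ_pi fun i => hs _
      have e : ∀ y : Fin p → E,
          (Set.univ.pi s).indicator (1 : (Fin (p + 1) → ℝ) → ℝ≥0∞)
            (pivots (p + 1) (gram ℝ (vecCons v y))) = (s 0).indicator 1 (‖v‖ ^ 2) *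
          (Set.univ.pi fun i : Fin p => s i.succ).indicator 1 (pivots p (gram ℝ fun i =>
            (ℝ ∙ v)ᗮ.orthogonalProjectionOnto (y i))) := fun y => by
        rw [pivots, schur_gram_vecCons, gram_vecCons_zero_zero, indicator_univ_pi_vecCons]
      simp only [e]
      have ih := map_pivots_gram p (ℝ ∙ v)ᗮ (by rw [finrank_orthogonal_singleton hv]; omega)
      rw [lintegral_const_mul' _ _ (by simp [Set.indicator]; split_ifs <;> simp)]
      congr 1
      rw [lintegral_pi_orthogonalProjectionOnto (ℝ ∙ v)ᗮ
        (G := fun z => (Set.univ.pi fun i : Fin p => s i.succ).indicator 1 (pivots p (gram ℝ z)))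
        ((measurable_one.indicator ht).comp (measurable_pivots_gram _)),
        ← lintegral_map (f := (Set.univ.pi fun i : Fin p => s i.succ).indicator 1)
          (measurable_one.indicator ht) (measurable_pivots_gram _), ih,
        lintegral_indicator_one ht]
      have : ∀ i : Fin p, IsProbabilityMeasure (chiSq (Module.finrank ℝ (ℝ ∙ v)ᗮ - i)) :=
        fun i => isProbabilityMeasure_chiSq (by rw [finrank_orthogonal_singleton hv]; omega)
      rw [Measure.pi_pi]
      refine Finset.prod_congr rfl fun i _ => ?_
      rw [finrank_orthogonal_singleton hv, Fin.val_succ, Nat.sub_sub, add_comm 1]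
    rw [lintegral_congr_ae hin, lintegral_mul_const _ (by
      have := hs 0
      exact (measurable_one.indicator this).comp (by fun_prop)), Fin.prod_univ_succ]
    congr 1
    rw [← lintegral_map (f := (s 0).indicator 1) (measurable_one.indicator (hs 0)) (by fun_prop),
      map_sq_norm_stdGaussian hE, lintegral_indicator_one (hs 0)]
    simp

theorem ae_posDef_gram {p : ℕ} (E : Type) [NormedAddCommGroup E] [InnerProductSpace ℝ E]
    [FiniteDimensional ℝ E] [MeasurableSpace E] [BorelSpace E] (hp : p ≤ Module.finrank ℝ E) :
    ∀ᵐ x ∂(Measure.pi fun _ : Fin p => stdGaussian E), (gram ℝ x).PosDef := by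
  have : ∀ i : Fin p, IsProbabilityMeasure (chiSq (Module.finrank ℝ E - i)) :=
    fun i => isProbabilityMeasure_chiSq (by omega)
  have h : ∀ᵐ w ∂(Measure.pi fun i : Fin p => chiSq (Module.finrank ℝ E - i)), ∀ i, 0 < w i := by
    rw [ae_all_iff]
    intro i
    exact (measurePreserving_eval _ i).quasiMeasurePreserving.ae
      (ae_pos_gammaMeasure _ _)
  rw [← map_pivots_gram p E hp] at h
  filter_upwards [ae_of_ae_map (measurable_pivots_gram p).aemeasurable h] with x hx
  refine posDef_of_pivots_pos ?_ hx
  ext i j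
  simp [real_inner_comm]

/-- Given the first vector v, an entry below the corner is the inner product of another vector with
v/‖v‖, of variance 1; the trailing block is the Cholesky factor in the complement of v. Second
moments suffice because the trace in the loss is linear in the squared entries. -/
theorem lintegral_sq_cholesky_gram : ∀ (p : ℕ) (E : Type) [NormedAddCommGroup E]
    [InnerProductSpace ℝ E] [FiniteDimensional ℝ E] [MeasurableSpace E] [BorelSpace E],
    p ≤ Module.finrank ℝ E → ∀ i j : Fin p,
    ∫⁻ x, ENNReal.ofReal (cholesky p (gram ℝ x) i j ^ 2)
      ∂(Measure.pi fun _ : Fin p => stdGaussian E) =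
      ENNReal.ofReal (if i < j then 0 else if i = j then (Module.finrank ℝ E : ℝ) - j else 1)
  | 0, _, _, _, _, _, _, _ => fun i => i.elim0
  | p + 1, E, _, _, _, _, _, hp => by
    intro i j
    have hE : 0 < Module.finrank ℝ E := by omega
    have hm : Measurable fun x : Fin (p + 1) → E =>
        ENNReal.ofReal (cholesky (p + 1) (gram ℝ x) i j ^ 2) :=
      ((measurable_cholesky measurable_gram i j).pow_const 2).ennreal_ofReal
    rw [lintegral_pi_vecCons _ hm]
    -- Away from the corner entry the inner integral does not depend on v, except on the null event
    -- v = 0.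
    have key : ∀ c : ℝ≥0∞, (∀ v : E, v ≠ 0 → ∫⁻ y : Fin p → E, ENNReal.ofReal
        (cholesky (p + 1) (gram ℝ (vecCons v y)) i j ^ 2) ∂(Measure.pi fun _ => stdGaussian E) = c) →
        ∫⁻ v, ∫⁻ y : Fin p → E, ENNReal.ofReal (cholesky (p + 1) (gram ℝ (vecCons v y)) i j ^ 2)
          ∂(Measure.pi fun _ => stdGaussian E) ∂(stdGaussian E) = c := by
      intro c hc
      rw [lintegral_congr_ae (g := fun _ => c)]
      · simp
      · filter_upwards [ae_ne_zero_stdGaussian hE] with v hv using hc v hv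
    obtain rfl | ⟨i, rfl⟩ := i.eq_zero_or_eq_succ <;> obtain rfl | ⟨j, rfl⟩ := j.eq_zero_or_eq_succ
    · have h1 : Integrable (fun x => x) (chiSq (Module.finrank ℝ E)) :=
        integrable_id_gammaMeasure (by positivity) (by norm_num)
      have h2 : ∫ x, x ∂(chiSq (Module.finrank ℝ E)) = Module.finrank ℝ E := by
        rw [chiSq, integral_id_gammaMeasure (by positivity) (by norm_num)]
        ring
      have h3 : 0 ≤ᵐ[chiSq (Module.finrank ℝ E)] fun x => x :=
        (ae_pos_gammaMeasure _ _).mono fun x hx => hx.le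
      have e : ∀ (v : E) (y : Fin p → E), cholesky (p + 1) (gram ℝ (vecCons v y)) 0 0 ^ 2 =
          ‖v‖ ^ 2 := fun v y => by simp [cholesky]
      simp only [e, lintegral_const, measure_univ, mul_one]
      rw [← lintegral_map (f := ENNReal.ofReal) (g := fun v : E => ‖v‖ ^ 2) (by fun_prop)
        (by fun_prop), map_sq_norm_stdGaussian hE, ← ofReal_integral_eq_lintegral_ofReal h1 h3, h2]
      simp
    · refine key _ fun v hv => ?_
      simp [cholesky, Fin.succ_pos]
    · refine key _ fun v hv => ?_
      have e : ∀ y : Fin p → E, cholesky (p + 1) (gram ℝ (vecCons v y)) i.succ 0 ^ 2 =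
          ⟪v, y i⟫ ^ 2 / ‖v‖ ^ 2 := fun y => by
        simp [cholesky, div_pow, real_inner_comm]
      simp only [e]
      have hv' : 0 < ‖v‖ := norm_pos_iff.2 hv
      have h := (measurePreserving_eval (fun _ : Fin p => stdGaussian E) i).lintegral_comp
        (f := fun u => ENNReal.ofReal (⟪v, u⟫ ^ 2 / ‖v‖ ^ 2)) (by fun_prop)
      simp only [Function.eval] at h
      rw [h, ← ofReal_integral_eq_lintegral_ofReal ((integrable_inner_sq_stdGaussian v).div_const _)
          (ae_of_all _ fun u => by positivity), integral_div, integral_inner_sq_stdGaussian,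
        div_self (by positivity)]
      simp [Fin.succ_ne_zero]
    · refine key _ fun v hv => ?_
      have ih := lintegral_sq_cholesky_gram p (ℝ ∙ v)ᗮ
        (by rw [finrank_orthogonal_singleton hv]; omega) i j
      have e : ∀ y : Fin p → E, cholesky (p + 1) (gram ℝ (vecCons v y)) i.succ j.succ =
          cholesky p (gram ℝ fun i => (ℝ ∙ v)ᗮ.orthogonalProjectionOnto (y i)) i j := fun y => by
        rw [← schur_gram_vecCons]
        simp [cholesky]
      simp only [e]
      rw [lintegral_pi_orthogonalProjectionOnto (ℝ ∙ v)ᗮ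
        (G := fun z => ENNReal.ofReal (cholesky p (gram ℝ z) i j ^ 2))
        ((measurable_cholesky measurable_gram i j).pow_const 2).ennreal_ofReal, ih,
        finrank_orthogonal_singleton hv, Nat.cast_sub (by omega)]
      simp only [Fin.succ_lt_succ_iff, Fin.succ_inj, Fin.val_succ]
      push_cast
      congr 2
      ring_nf

end Gaussian

/-! ### The scatter matrix of a Gaussian sample -/

section Sample

open scoped RealInnerProductSpace

variable {n p : ℕ}

/-- The sample obtained from `p` columns of independent standard Gaussian variables through the
matrix `K`. -/
noncomputable def sampleOfColumns (K : Matrix (Fin p) (Fin p) ℝ)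
    (Y : Fin p → EuclideanSpace ℝ (Fin n)) : Fin n → EuclideanSpace ℝ (Fin p) :=
  fun i => WithLp.toLp 2 (K *ᵥ fun j => Y j i)

theorem continuous_sampleOfColumns (K : Matrix (Fin p) (Fin p) ℝ) :
    Continuous (sampleOfColumns (n := n) K) := by
  unfold sampleOfColumns mulVec dotProduct
  fun_prop

theorem sampleOfColumns_injective {K : Matrix (Fin p) (Fin p) ℝ} (hK : IsUnit K.det) :
    Function.Injective (sampleOfColumns (n := n) K) := by
  intro Y Z h
  have hinj := Matrix.mulVec_injective_iff_isUnit.2 ((Matrix.isUnit_iff_isUnit_det K).2 hK)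
  have h' : ∀ i : Fin n, (fun j => Y j i) = fun j => Z j i := fun i =>
    hinj (congrArg WithLp.ofLp (congrFun h i))
  funext j
  ext i
  exact congrFun (h' i) j

theorem scatter_sampleOfColumns (K : Matrix (Fin p) (Fin p) ℝ)
    (Y : Fin p → EuclideanSpace ℝ (Fin n)) :
    scatter (sampleOfColumns K Y) = K * gram ℝ Y * Kᵀ := by
  have h : ∀ i, (sampleOfColumns K Y i).ofLp = K *ᵥ fun j => Y j i := fun i => rfl
  have hg : gram ℝ Y = ∑ i : Fin n, vecMulVec (fun j => Y j i) (fun j => Y j i) := by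
    ext a b
    simp only [gram_apply, PiLp.inner_apply, Matrix.sum_apply, vecMulVec_apply]
    exact Finset.sum_congr rfl fun i _ => by simp [mul_comm]
  rw [scatter, hg, Finset.mul_sum, Finset.sum_mul]
  refine Finset.sum_congr rfl fun i _ => ?_
  rw [h, mul_vecMulVec, vecMulVec_mul, vecMul_transpose]

/-- Characteristic functions are compared on the product spaces. The transpose of the linear map
sends t to s, and ‖s‖² is the sum of the quadratic forms t_i' K K' t_i. -/
theorem measurePreserving_sampleOfColumns {K S : Matrix (Fin p) (Fin p) ℝ} (hS : S.PosSemidef)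
    (hK : K * Kᵀ = S) :
    MeasurePreserving (sampleOfColumns (n := n) K)
      (Measure.pi fun _ => stdGaussian (EuclideanSpace ℝ (Fin n))) (sampleLaw n S) := by
  have hm : Measurable (sampleOfColumns (n := n) K) := (continuous_sampleOfColumns K).measurable
  refine ⟨hm, ?_⟩
  have : IsProbabilityMeasure ((Measure.pi fun _ : Fin p => stdGaussian
    (EuclideanSpace ℝ (Fin n))).map (sampleOfColumns K)) :=
    Measure.isProbabilityMeasure_map hm.aemeasurable
  refine charFun_eq_pi_iff.1 fun t => ?_
  let s : PiLp 2 fun _ : Fin p => EuclideanSpace ℝ (Fin n) :=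
    WithLp.toLp 2 fun j => WithLp.toLp 2 fun i => ∑ k, K k j * t i k
  have h := charFun_pi (μ := fun _ : Fin p => stdGaussian (EuclideanSpace ℝ (Fin n))) s
  have e : ∀ Y : Fin p → EuclideanSpace ℝ (Fin n),
      ⟪WithLp.toLp 2 (sampleOfColumns K Y), t⟫ = ⟪WithLp.toLp 2 Y, s⟫ := fun Y => by
    simp only [PiLp.inner_apply, s, sampleOfColumns, mulVec, dotProduct, RCLike.inner_apply,
      conj_trivial, Finset.mul_sum, Finset.sum_mul]
    conv_rhs => rw [Finset.sum_comm]
    refine Finset.sum_congr rfl fun i _ => ?_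
    rw [Finset.sum_comm]
    exact Finset.sum_congr rfl fun j _ => Finset.sum_congr rfl fun k _ => by ring
  rw [charFun_apply, integral_map (by fun_prop) (by fun_prop),
    integral_map hm.aemeasurable (by fun_prop)]
  rw [charFun_apply, integral_map (by fun_prop) (by fun_prop)] at h
  simp only [e]
  rw [h]
  simp only [charFun_stdGaussian, charFun_multivariateGaussian hS, ← Complex.exp_sum]
  congr 1
  have hq : ∀ i, (t i).ofLp ⬝ᵥ S *ᵥ (t i).ofLp = ∑ j, (∑ k, K k j * t i k) ^ 2 := fun i => by
    rw [← hK, ← mulVec_mulVec, dotProduct_mulVec, ← mulVec_transpose]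
    simp only [dotProduct, mulVec, transpose_apply, sq]
  have hs : ∀ j, ‖s j‖ ^ 2 = ∑ i, (∑ k, K k j * t i k) ^ 2 := fun j => by
    rw [EuclideanSpace.real_norm_sq_eq]
  have hr : ∑ j, ‖s j‖ ^ 2 = ∑ i, (t i).ofLp ⬝ᵥ S *ᵥ (t i).ofLp := by
    simp only [hq, hs]
    exact Finset.sum_comm
  simp only [inner_zero_right, Complex.ofReal_zero, zero_mul, zero_sub, Finset.sum_neg_distrib,
    neg_div, ← Finset.sum_div]
  congr 2
  exact_mod_cast hr

/-- The scatter matrix of a Gaussian sample is distributed as `K W Kᵀ` for a Gram matrix `W` of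
independent standard Gaussian vectors. -/
theorem lintegral_scatter {K S : Matrix (Fin p) (Fin p) ℝ} (hS : S.PosSemidef)
    (hK : K * Kᵀ = S) (hKu : IsUnit K.det) (F : Matrix (Fin p) (Fin p) ℝ → ℝ≥0∞) :
    ∫⁻ X, F (scatter X) ∂(sampleLaw n S) =
      ∫⁻ Y, F (K * gram ℝ Y * Kᵀ)
        ∂(Measure.pi fun _ => stdGaussian (EuclideanSpace ℝ (Fin n))) := by
  -- A continuous injection of Polish spaces is a measurable embedding, so F may be arbitrary. This
  -- matters because estimators are unrestricted off the positive diagonal matrices.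
  rw [← (measurePreserving_sampleOfColumns hS hK).lintegral_comp_emb
    ((continuous_sampleOfColumns K).measurableEmbedding (sampleOfColumns_injective hKu))]
  simp only [scatter_sampleOfColumns]

end Sample

/-! ### Moments of the pivots and reduction of the risk -/

section Risk

variable {n p : ℕ}

/-- The law of `p` independent standard Gaussian vectors in `ℝⁿ`. -/
noncomputable abbrev columnLaw (n p : ℕ) : Measure (Fin p → EuclideanSpace ℝ (Fin n)) :=
  Measure.pi fun _ => stdGaussian (EuclideanSpace ℝ (Fin n))

theorem ae_posDef_gram_columnLaw (hnp : p ≤ n) : ∀ᵐ Y ∂(columnLaw n p), (gram ℝ Y).PosDef :=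
  ae_posDef_gram _ (by simpa using hnp)

theorem map_pivots_columnLaw (hnp : p ≤ n) :
    (columnLaw n p).map (fun Y => pivots p (gram ℝ Y)) =
      Measure.pi fun i : Fin p => chiSq (n - i) := by
  have h := map_pivots_gram p (EuclideanSpace ℝ (Fin n)) (by simpa using hnp)
  simpa only [finrank_euclideanSpace, Fintype.card_fin] using h

theorem lintegral_sq_cholesky (hnp : p ≤ n) (i j : Fin p) :
    ∫⁻ Y, ENNReal.ofReal (cholesky p (gram ℝ Y) i j ^ 2) ∂(columnLaw n p) =
      ENNReal.ofReal (if i < j then 0 else if i = j then (n : ℝ) - j else 1) := by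
  have h := lintegral_sq_cholesky_gram p (EuclideanSpace ℝ (Fin n)) (by simpa using hnp) i j
  simpa only [finrank_euclideanSpace, Fintype.card_fin] using h

theorem integrable_sq_cholesky (hnp : p ≤ n) (i j : Fin p) :
    Integrable (fun Y => cholesky p (gram ℝ Y) i j ^ 2) (columnLaw n p) := by
  refine ⟨((measurable_cholesky measurable_gram i j).pow_const 2).aestronglyMeasurable, ?_⟩
  rw [hasFiniteIntegral_iff_ofReal (ae_of_all _ fun Y => sq_nonneg _), lintegral_sq_cholesky hnp]
  exact ENNReal.ofReal_lt_top

theorem integral_sq_cholesky (hnp : p ≤ n) (i j : Fin p) :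
    ∫ Y, cholesky p (gram ℝ Y) i j ^ 2 ∂(columnLaw n p) =
      if i < j then 0 else if i = j then (n : ℝ) - j else 1 := by
  have hj : ((j : ℕ) : ℝ) ≤ n := by exact_mod_cast (j.2.le.trans hnp)
  rw [integral_eq_lintegral_of_nonneg_ae (ae_of_all _ fun Y => sq_nonneg _)
    (integrable_sq_cholesky hnp i j).aestronglyMeasurable, lintegral_sq_cholesky hnp,
    ENNReal.toReal_ofReal]
  split_ifs <;> linarith

theorem integrable_pivots (hnp : p ≤ n) (i : Fin p) :
    Integrable (fun Y => pivots p (gram ℝ Y) i) (columnLaw n p) := by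
  refine (integrable_sq_cholesky hnp i i).congr ?_
  filter_upwards [ae_posDef_gram_columnLaw hnp] with Y hY
  rw [pivots_eq_sq_cholesky hY]

theorem integral_pivots (hnp : p ≤ n) (i : Fin p) :
    ∫ Y, pivots p (gram ℝ Y) i ∂(columnLaw n p) = (n : ℝ) - i := by
  rw [← (by simpa using integral_sq_cholesky hnp i i :
    ∫ Y, cholesky p (gram ℝ Y) i i ^ 2 ∂(columnLaw n p) = (n : ℝ) - i)]
  refine integral_congr_ae ?_
  filter_upwards [ae_posDef_gram_columnLaw hnp] with Y hY
  rw [pivots_eq_sq_cholesky hY]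

theorem measurePreserving_pivots (hnp : p ≤ n) (i : Fin p) :
    MeasurePreserving (fun Y => pivots p (gram ℝ Y) i) (columnLaw n p) (chiSq (n - i)) := by
  have : ∀ i : Fin p, IsProbabilityMeasure (chiSq (n - i)) :=
    fun i => isProbabilityMeasure_chiSq (by omega)
  exact (measurePreserving_eval (fun i : Fin p => chiSq (n - i)) i).comp
    ⟨measurable_pivots_gram p, map_pivots_columnLaw hnp⟩

theorem integrable_log_pivots (hnp : p ≤ n) (i : Fin p) :
    Integrable (fun Y => Real.log (pivots p (gram ℝ Y) i)) (columnLaw n p) :=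
  (measurePreserving_pivots hnp i).integrable_comp_of_integrable
    (integrable_log_chiSq (by omega))

theorem integral_log_pivots (hnp : p ≤ n) (i : Fin p) :
    ∫ Y, Real.log (pivots p (gram ℝ Y) i) ∂(columnLaw n p) =
      ∫ x, Real.log x ∂(chiSq (n - i)) := by
  have h := measurePreserving_pivots hnp i
  rw [← h.map_eq, integral_map h.measurable.aemeasurable (by fun_prop)]

theorem lintegral_scatter_cholesky {S : Matrix (Fin p) (Fin p) ℝ} (hS : S.PosDef)
    (F : Matrix (Fin p) (Fin p) ℝ → ℝ≥0∞) :
    ∫⁻ X, F (scatter X) ∂(sampleLaw n S) =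
      ∫⁻ Y, F (cholesky p S * gram ℝ Y * (cholesky p S)ᵀ) ∂(columnLaw n p) := by
  obtain ⟨h1, h2, h3⟩ := cholesky_spec p S hS
  exact lintegral_scatter hS.posSemidef h3 (lower_isUnit_det h1 h2) F

/-- Conjugation by the Cholesky factor of S multiplies the pivots, so the risk depends on S only
through its pivots. -/
theorem starRisk_eq_lintegral (hnp : p ≤ n) (φ : Matrix (Fin p) (Fin p) ℝ → Matrix (Fin p) (Fin p) ℝ)
    {S : Matrix (Fin p) (Fin p) ℝ} (hS : S.PosDef) :
    starRisk n φ S = ∫⁻ Y, ENNReal.ofReal (steinLoss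
      (φ (diagonal fun i => pivots p S i * pivots p (gram ℝ Y) i)) (diagonal (pivots p S)))
        ∂(columnLaw n p) := by
  obtain ⟨h1, h2, h3⟩ := cholesky_spec p S hS
  rw [starRisk, lintegral_scatter_cholesky hS
    (fun A => ENNReal.ofReal (steinLoss (φ (reduce A)) (reduce S)))]
  refine lintegral_congr_ae ?_
  filter_upwards [ae_posDef_gram_columnLaw hnp] with Y hY
  have : pivots p (cholesky p S * gram ℝ Y * (cholesky p S)ᵀ) =
      fun i => pivots p S i * pivots p (gram ℝ Y) i :=
    funext fun i => by rw [pivots_conj h1 h2 hY, pivots_eq_sq_cholesky hS]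
  rw [reduce, reduce, this]

theorem posDef_diagonal {w : Fin p → ℝ} (hw : ∀ i, 0 < w i) : (diagonal w).PosDef :=
  Matrix.PosDef.diagonal hw

theorem diagonal_sqrt_mul_self {w : Fin p → ℝ} (hw : ∀ i, 0 < w i) :
    (diagonal fun i => √(w i)) * 1 * (diagonal fun i => √(w i))ᵀ = diagonal w := by
  rw [Matrix.mul_one, diagonal_transpose, diagonal_mul_diagonal]
  simp only [Real.mul_self_sqrt (hw _).le]

theorem isUnit_det_diagonal_sqrt {w : Fin p → ℝ} (hw : ∀ i, 0 < w i) :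
    IsUnit (diagonal fun i => √(w i)).det := by
  rw [det_diagonal]
  exact (Finset.prod_pos fun i _ => Real.sqrt_pos.2 (hw i)).ne'.isUnit

theorem integral_sub_add_const {α : Type*} [MeasurableSpace α] {μ : Measure α}
    [IsProbabilityMeasure μ] {f g : α → ℝ} (hf : Integrable f μ) (hg : Integrable g μ) (c : ℝ) :
    ∫ x, (f x - g x + c) ∂μ = ∫ x, f x ∂μ - ∫ x, g x ∂μ + c := by
  rw [integral_add (f := fun x => f x - g x) (hf.sub hg) (integrable_const c),
    integral_sub hf hg]
  simp

/-! ### Invariant estimators -/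

section Invariant

variable {φ : Matrix (Fin p) (Fin p) ℝ → Matrix (Fin p) (Fin p) ℝ}

/-- The diagonal group is transitive: the square root of w carries the identity to Diag(w). -/
theorem IsInvariant.apply_diagonal (h : IsInvariant φ) {w : Fin p → ℝ} (hw : ∀ i, 0 < w i) :
    φ (diagonal w) = (diagonal fun i => √(w i)) * φ 1 * (diagonal fun i => √(w i))ᵀ := by
  have := h (fun i => √(w i)) 1 (fun i => Real.sqrt_pos.2 (hw i)) (fun _ => one_pos)
  rw [Pi.one_def, diagonal_one, diagonal_sqrt_mul_self hw] at this
  exact this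

theorem IsEstimator.posDef_one (h : IsEstimator φ) : (φ 1).PosDef := by
  have := h.posDef 1 (fun _ => one_pos)
  rwa [Pi.one_def, diagonal_one] at this

theorem IsInvariant.steinLoss_eq (h : IsInvariant φ) (hφ : IsEstimator φ) {s w : Fin p → ℝ}
    (hs : ∀ i, 0 < s i) (hw : ∀ i, 0 < w i) :
    steinLoss (φ (diagonal fun i => s i * w i)) (diagonal s) =
      ∑ i, w i * φ 1 i i - ∑ i, Real.log (w i) + (-Real.log (φ 1).det - p) := by
  have e := h (fun i => √(s i)) w (fun i => Real.sqrt_pos.2 (hs i)) hw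
  have e' : (diagonal fun i => √(s i)) * diagonal w * (diagonal fun i => √(s i))ᵀ =
      diagonal fun i => s i * w i := by
    rw [diagonal_transpose, diagonal_mul_diagonal, diagonal_mul_diagonal]
    congr 1
    funext i
    rw [mul_right_comm, Real.mul_self_sqrt (hs i).le]
  rw [e'] at e
  rw [e, ← diagonal_sqrt_mul_self hs, steinLoss_conj (isUnit_det_diagonal_sqrt hs),
    h.apply_diagonal hw, steinLoss_one, det_mul, det_mul, det_transpose, mul_right_comm,
    ← det_mul, diagonal_mul_diagonal, det_diagonal]
  simp only [Real.mul_self_sqrt (hw _).le]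
  rw [Real.log_mul (Finset.prod_pos fun i _ => hw i).ne' hφ.posDef_one.det_pos.ne',
    Real.log_prod fun i _ => (hw i).ne']
  have ht : ((diagonal fun i => √(w i)) * φ 1 * (diagonal fun i => √(w i))ᵀ).trace =
      ∑ i, w i * φ 1 i i := by
    simp only [trace, diag_apply, diagonal_transpose, mul_diagonal, diagonal_mul]
    exact Finset.sum_congr rfl fun i _ => by rw [mul_right_comm, Real.mul_self_sqrt (hw i).le]
  rw [ht]
  ring

/-- Only the means of w_i and of log w_i enter, and what exceeds `minRisk` is again a Stein loss.
The second conjunct allows equal risks to be cancelled through `ENNReal.ofReal` in the uniqueness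
proof. -/
theorem starRisk_invariant (hnp : p ≤ n) (h : IsInvariant φ) (hφ : IsEstimator φ)
    {S : Matrix (Fin p) (Fin p) ℝ} (hS : S.PosDef) :
    starRisk n φ S = ENNReal.ofReal
        (minRisk n p + steinLoss (φ 1) (diagonal fun i : Fin p => ((n : ℝ) - i)⁻¹)) ∧
      0 ≤ minRisk n p + steinLoss (φ 1) (diagonal fun i : Fin p => ((n : ℝ) - i)⁻¹) := by
  have hd : ∀ i : Fin p, 0 < (n : ℝ) - i := fun i => by
    have : ((i : ℕ) : ℝ) < n := by exact_mod_cast i.2.trans_le hnp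
    linarith
  let f : (Fin p → EuclideanSpace ℝ (Fin n)) → ℝ := fun Y =>
    ∑ i, pivots p (gram ℝ Y) i * φ 1 i i - ∑ i, Real.log (pivots p (gram ℝ Y) i) +
      (-Real.log (φ 1).det - p)
  have hae : ∀ᵐ Y ∂(columnLaw n p), steinLoss
      (φ (diagonal fun i => pivots p S i * pivots p (gram ℝ Y) i)) (diagonal (pivots p S)) = f Y := by
    filter_upwards [ae_posDef_gram_columnLaw hnp] with Y hY
    exact h.steinLoss_eq hφ (pivots_pos hS) (pivots_pos hY)
  have hf0 : 0 ≤ᵐ[columnLaw n p] f := by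
    filter_upwards [ae_posDef_gram_columnLaw hnp, hae] with Y hY hf
    rw [← hf]
    exact steinLoss_nonneg (hφ.posDef _ fun i => mul_pos (pivots_pos hS i) (pivots_pos hY i))
      (posDef_diagonal (pivots_pos hS))
  have i1 : Integrable (fun Y => ∑ i, pivots p (gram ℝ Y) i * φ 1 i i) (columnLaw n p) :=
    integrable_finsetSum _ fun i _ => (integrable_pivots hnp i).mul_const _
  have i2 : Integrable (fun Y => ∑ i, Real.log (pivots p (gram ℝ Y) i)) (columnLaw n p) :=
    integrable_finsetSum _ fun i _ => integrable_log_pivots hnp i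
  have hfi : Integrable f (columnLaw n p) :=
    (i1.sub i2).add (integrable_const _)
  have hint : ∫ Y, f Y ∂(columnLaw n p) =
      minRisk n p + steinLoss (φ 1) (diagonal fun i : Fin p => ((n : ℝ) - i)⁻¹) := by
    rw [steinLoss_diagonal_inv hφ.posDef_one hd, minRisk]
    simp only [f]
    rw [integral_sub_add_const i1 i2,
      integral_finsetSum _ fun i _ => (integrable_pivots hnp i).mul_const _,
      integral_finsetSum _ fun i _ => integrable_log_pivots hnp i]
    simp only [integral_mul_const, integral_pivots hnp, integral_log_pivots hnp,
      Finset.sum_sub_distrib]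
    ring
  rw [← hint]
  refine ⟨?_, integral_nonneg_of_ae hf0⟩
  rw [starRisk_eq_lintegral hnp φ hS, ofReal_integral_eq_lintegral_ofReal hfi hf0]
  refine lintegral_congr_ae ?_
  filter_upwards [hae] with Y hY
  rw [hY]

end Invariant

theorem inv_diagonal_of_pos {d : Fin p → ℝ} (hd : ∀ i, 0 < d i) :
    (diagonal d)⁻¹ = diagonal fun i => (d i)⁻¹ := by
  refine Matrix.inv_eq_right_inv ?_
  rw [diagonal_mul_diagonal]
  simp only [mul_inv_cancel₀ (hd _).ne', diagonal_one]

theorem sub_val_pos (hnp : p ≤ n) (i : Fin p) : 0 < (n : ℝ) - i := by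
  have : ((i : ℕ) : ℝ) < n := by exact_mod_cast i.2.trans_le hnp
  linarith

theorem bestEst_diagonal (hnp : p ≤ n) (a : Fin p → ℝ) :
    bestEst n (diagonal a) = diagonal fun i : Fin p => ((n : ℝ) - i)⁻¹ * a i := by
  rw [bestEst, inv_diagonal_of_pos (sub_val_pos hnp), diagonal_mul_diagonal]

theorem isEstimator_bestEst (hnp : p ≤ n) : IsEstimator (bestEst n (p := p)) where
  posDef a ha := by
    rw [bestEst_diagonal hnp]
    exact posDef_diagonal fun i => mul_pos (inv_pos.2 (sub_val_pos hnp i)) (ha i)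
  measurable i j := by
    simp only [bestEst_diagonal hnp, diagonal_apply]
    have : Measurable fun a : {a : Fin p → ℝ // ∀ i, 0 < a i} => a.1 i :=
      (measurable_pi_apply i).comp measurable_subtype_coe
    split_ifs
    · exact this.const_mul _
    · exact measurable_const

theorem isInvariant_bestEst (hnp : p ≤ n) : IsInvariant (bestEst n (p := p)) := by
  intro g a _ _
  rw [diagonal_transpose, diagonal_mul_diagonal, diagonal_mul_diagonal, bestEst_diagonal hnp,
    bestEst_diagonal hnp, diagonal_mul_diagonal, diagonal_mul_diagonal]
  congr 1
  funext i
  ring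

theorem bestEst_one (hnp : p ≤ n) :
    bestEst n (1 : Matrix (Fin p) (Fin p) ℝ) = diagonal fun i : Fin p => ((n : ℝ) - i)⁻¹ := by
  rw [← diagonal_one, bestEst_diagonal hnp]
  simp

theorem steinLoss_self {S : Matrix (Fin p) (Fin p) ℝ} (hS : S.PosDef) : steinLoss S S = 0 := by
  rw [steinLoss, Matrix.nonsing_inv_mul _ hS.det_pos.ne'.isUnit]
  simp

theorem posDef_inv_sub_val (hnp : p ≤ n) :
    (diagonal fun i : Fin p => ((n : ℝ) - i)⁻¹).PosDef :=
  posDef_diagonal fun i => inv_pos.2 (sub_val_pos hnp i)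

theorem starRisk_bestEst (hnp : p ≤ n) {S : Matrix (Fin p) (Fin p) ℝ} (hS : S.PosDef) :
    starRisk n (bestEst n) S = ENNReal.ofReal (minRisk n p) ∧ 0 ≤ minRisk n p := by
  have h := starRisk_invariant hnp (isInvariant_bestEst hnp) (isEstimator_bestEst hnp) hS
  rwa [bestEst_one hnp, steinLoss_self (posDef_inv_sub_val hnp), add_zero] at h

theorem starRisk_bestEst_le {φ : Matrix (Fin p) (Fin p) ℝ → Matrix (Fin p) (Fin p) ℝ}
    (hnp : p ≤ n) (h : IsInvariant φ) (hφ : IsEstimator φ)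
    {S : Matrix (Fin p) (Fin p) ℝ} (hS : S.PosDef) :
    starRisk n (bestEst n) S ≤ starRisk n φ S := by
  rw [(starRisk_bestEst hnp hS).1, (starRisk_invariant hnp h hφ hS).1]
  exact ENNReal.ofReal_le_ofReal (le_add_of_nonneg_right
    (steinLoss_nonneg hφ.posDef_one (posDef_inv_sub_val hnp)))

theorem eq_bestEst_of_starRisk_eq {φ : Matrix (Fin p) (Fin p) ℝ → Matrix (Fin p) (Fin p) ℝ}
    (hnp : p ≤ n) (h : IsInvariant φ) (hφ : IsEstimator φ)
    {S : Matrix (Fin p) (Fin p) ℝ} (hS : S.PosDef)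
    (he : starRisk n φ S = starRisk n (bestEst n) S) {a : Fin p → ℝ} (ha : ∀ i, 0 < a i) :
    φ (diagonal a) = bestEst n (diagonal a) := by
  obtain ⟨h1, h2⟩ := starRisk_invariant hnp h hφ hS
  obtain ⟨h3, h4⟩ := starRisk_bestEst hnp hS
  rw [h1, h3, ENNReal.ofReal_eq_ofReal_iff h2 h4, add_eq_left] at he
  rw [h.apply_diagonal ha, (isInvariant_bestEst hnp).apply_diagonal ha, bestEst_one hnp,
    eq_of_steinLoss_eq_zero hφ.posDef_one (posDef_inv_sub_val hnp) he]

/-! ### The Cholesky and maximum likelihood estimators -/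

section Covariance

/-- The estimator `T D⁻¹ Tᵀ` with `D = Diag(d)` and `T` the Cholesky factor. -/
noncomputable def choleskyEst (d : Fin p → ℝ) (A : Matrix (Fin p) (Fin p) ℝ) :
    Matrix (Fin p) (Fin p) ℝ :=
  cholesky p A * (diagonal d)⁻¹ * (cholesky p A)ᵀ

/-- Column j has expected square n - j on the diagonal and 1 at each of the p - 1 - j places below.
This is the origin of D_S. -/
theorem sum_integral_sq_cholesky (j : Fin p) :
    ∑ i : Fin p, (if i < j then 0 else if i = j then (n : ℝ) - j else 1) =
      (n : ℝ) + p - 2 * j - 1 := by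
  have e : ∀ i : Fin p, (if i < j then 0 else if i = j then (n : ℝ) - j else 1) =
      (if i = j then (n : ℝ) - j else 0) + if i ∈ Finset.Ioi j then 1 else 0 := fun i => by
    rcases lt_trichotomy i j with h | h | h
    · simp [h, h.ne, h.le]
    · simp [h]
    · simp [h, h.ne', h.not_gt]
  simp only [e, Finset.sum_add_distrib, Finset.sum_ite_eq', Finset.mem_univ, if_true,
    Finset.sum_ite_mem, Finset.univ_inter, Finset.sum_const, Fin.card_Ioi, nsmul_eq_mul, mul_one]
  rw [Nat.sub_sub, Nat.cast_sub (by omega)]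
  push_cast
  ring

theorem steinLoss_choleskyEst_one {d : Fin p → ℝ} (hd : ∀ i, 0 < d i)
    {W : Matrix (Fin p) (Fin p) ℝ} (hW : W.PosDef) :
    steinLoss (choleskyEst d W) 1 = ∑ i, ∑ j, cholesky p W i j ^ 2 * (d j)⁻¹ -
      ∑ i, Real.log (pivots p W i) + (∑ i, Real.log (d i) - p) := by
  obtain ⟨h1, h2, h3⟩ := cholesky_spec p W hW
  have ht : (choleskyEst d W).trace = ∑ i, ∑ j, cholesky p W i j ^ 2 * (d j)⁻¹ := by
    rw [choleskyEst, inv_diagonal_of_pos hd]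
    simp only [trace, diag_apply, mul_apply (M := cholesky p W * _), mul_diagonal, transpose_apply]
    exact Finset.sum_congr rfl fun i _ => Finset.sum_congr rfl fun j _ => by ring
  have hdet : (choleskyEst d W).det = (∏ i, (d i)⁻¹) * W.det := by
    conv_rhs => rw [← h3]
    rw [choleskyEst, inv_diagonal_of_pos hd, det_mul, det_mul, det_mul, det_diagonal]
    ring
  rw [steinLoss_one, ht, hdet, Real.log_mul (Finset.prod_pos fun i _ => inv_pos.2 (hd i)).ne'
    hW.det_pos.ne', Real.log_prod fun i _ => (inv_pos.2 (hd i)).ne', log_det_eq_sum hW]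
  simp only [Real.log_inv, Finset.sum_neg_distrib]
  ring

theorem posDef_choleskyEst {d : Fin p → ℝ} (hd : ∀ i, 0 < d i)
    {W : Matrix (Fin p) (Fin p) ℝ} (hW : W.PosDef) : (choleskyEst d W).PosDef := by
  obtain ⟨h1, h2, _⟩ := cholesky_spec p W hW
  rw [choleskyEst, inv_diagonal_of_pos hd]
  exact posDef_conj (lower_isUnit_det h1 h2) (posDef_diagonal fun i => inv_pos.2 (hd i))

/-- Equivariance of T removes S. The condition `hsum` says that the expected trace is p, which
cancels the constant of the loss and leaves only logarithms. -/
theorem risk_eq_choleskyEst (hnp : p ≤ n) {d : Fin p → ℝ} (hd : ∀ i, 0 < d i)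
    (hsum : ∑ j : Fin p, ((n : ℝ) + p - 2 * j - 1) * (d j)⁻¹ = p)
    {ψ : Matrix (Fin p) (Fin p) ℝ → Matrix (Fin p) (Fin p) ℝ}
    (hψ : ∀ A : Matrix (Fin p) (Fin p) ℝ, A.PosDef → ψ A = choleskyEst d A)
    {S : Matrix (Fin p) (Fin p) ℝ} (hS : S.PosDef) :
    risk n ψ S = ENNReal.ofReal
      (∑ i : Fin p, (Real.log (d i) - ∫ x, Real.log x ∂(chiSq (n - i)))) := by
  obtain ⟨h1, h2, h3⟩ := cholesky_spec p S hS
  have hu := lower_isUnit_det h1 h2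
  let f : (Fin p → EuclideanSpace ℝ (Fin n)) → ℝ := fun Y =>
    ∑ i, ∑ j, cholesky p (gram ℝ Y) i j ^ 2 * (d j)⁻¹ -
      ∑ i, Real.log (pivots p (gram ℝ Y) i) + (∑ i, Real.log (d i) - p)
  have hae : ∀ᵐ Y ∂(columnLaw n p), steinLoss
      (ψ (cholesky p S * gram ℝ Y * (cholesky p S)ᵀ)) S = f Y ∧ 0 ≤ f Y := by
    filter_upwards [ae_posDef_gram_columnLaw hnp] with Y hY
    have e : choleskyEst d (cholesky p S * gram ℝ Y * (cholesky p S)ᵀ) =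
        cholesky p S * choleskyEst d (gram ℝ Y) * (cholesky p S)ᵀ := by
      rw [choleskyEst, choleskyEst, cholesky_conj h1 h2 hY, transpose_mul]
      simp only [Matrix.mul_assoc]
    have e2 := steinLoss_conj hu (choleskyEst d (gram ℝ Y)) 1
    rw [Matrix.mul_one, h3] at e2
    simp only [f]
    rw [← steinLoss_choleskyEst_one hd hY]
    refine ⟨?_, steinLoss_one_nonneg (posDef_choleskyEst hd hY)⟩
    rw [hψ _ (posDef_conj hu hY), e, e2]
  have i1 : ∀ i, Integrable (fun Y => ∑ j, cholesky p (gram ℝ Y) i j ^ 2 * (d j)⁻¹)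
      (columnLaw n p) := fun i =>
    integrable_finsetSum _ fun j _ => (integrable_sq_cholesky hnp i j).mul_const _
  have i1' : Integrable (fun Y => ∑ i, ∑ j, cholesky p (gram ℝ Y) i j ^ 2 * (d j)⁻¹)
      (columnLaw n p) := integrable_finsetSum _ fun i _ => i1 i
  have i2 : Integrable (fun Y => ∑ i, Real.log (pivots p (gram ℝ Y) i)) (columnLaw n p) :=
    integrable_finsetSum _ fun i _ => integrable_log_pivots hnp i
  have hfi : Integrable f (columnLaw n p) :=
    (i1'.sub i2).add (integrable_const _)
  have hint : ∫ Y, f Y ∂(columnLaw n p) =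
      ∑ i : Fin p, (Real.log (d i) - ∫ x, Real.log x ∂(chiSq (n - i))) := by
    simp only [f]
    rw [integral_sub_add_const i1' i2,
      integral_finsetSum _ fun i _ => i1 i,
      integral_finsetSum _ fun i _ => integrable_log_pivots hnp i]
    have e : ∀ i, ∫ Y, ∑ j, cholesky p (gram ℝ Y) i j ^ 2 * (d j)⁻¹ ∂(columnLaw n p) =
        ∑ j, (if i < j then 0 else if i = j then (n : ℝ) - j else 1) * (d j)⁻¹ := fun i => by
      rw [integral_finsetSum _ fun j _ => (integrable_sq_cholesky hnp i j).mul_const _]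
      exact Finset.sum_congr rfl fun j _ => by rw [integral_mul_const, integral_sq_cholesky hnp]
    simp only [e, integral_log_pivots hnp, Finset.sum_sub_distrib]
    rw [Finset.sum_comm]
    simp only [← Finset.sum_mul, sum_integral_sq_cholesky]
    rw [hsum]
    ring
  rw [← hint, ofReal_integral_eq_lintegral_ofReal hfi (hae.mono fun Y hY => hY.2), risk,
    lintegral_scatter_cholesky hS (fun A => ENNReal.ofReal (steinLoss (ψ A) S))]
  refine lintegral_congr_ae ?_
  filter_upwards [hae] with Y hY
  rw [hY.1]

theorem steinEst_denominator_ge (n : ℕ) (i : Fin p) :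
    (n : ℝ) - i ≤ (n : ℝ) + p - 2 * i - 1 := by
  have : ((i : ℕ) : ℝ) + 1 ≤ p := by exact_mod_cast i.2
  linarith

theorem steinEst_denominator_pos (hnp : p ≤ n) (i : Fin p) : 0 < (n : ℝ) + p - 2 * i - 1 :=
  (sub_val_pos hnp i).trans_le (steinEst_denominator_ge n i)

theorem risk_steinEst (hnp : p ≤ n) {S : Matrix (Fin p) (Fin p) ℝ} (hS : S.PosDef) :
    risk n (steinEst n) S = ENNReal.ofReal (∑ i : Fin p,
      (Real.log ((n : ℝ) + p - 2 * i - 1) - ∫ x, Real.log x ∂(chiSq (n - i)))) := by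
  refine risk_eq_choleskyEst hnp (steinEst_denominator_pos hnp) ?_ (fun A _ => rfl) hS
  rw [Finset.sum_congr rfl fun j _ => mul_inv_cancel₀ (steinEst_denominator_pos hnp j).ne']
  simp

theorem sum_steinEst_denominator (n p : ℕ) :
    ∑ j : Fin p, ((n : ℝ) + p - 2 * j - 1) = p * n := by
  have h : ∑ j : Fin p, ((j : ℕ) : ℝ) * 2 = p * (p - 1) := by
    rw [← Finset.sum_mul, Fin.sum_univ_eq_sum_range (fun i => (i : ℝ)), ← Nat.cast_sum]
    have := Finset.sum_range_id_mul_two p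
    rcases p with _ | p
    · simp
    · rw [Nat.add_sub_cancel] at this
      rw [Nat.cast_add_one, add_sub_cancel_right]
      exact_mod_cast this
  have e : ∀ j : Fin p, (n : ℝ) + p - 2 * j - 1 = ((n : ℝ) + p - 1) - ((j : ℕ) : ℝ) * 2 :=
    fun j => by ring
  simp only [e, Finset.sum_sub_distrib (f := fun _ => (n : ℝ) + p - 1), h]
  simp
  ring

theorem risk_mle (hnp : p ≤ n) {S : Matrix (Fin p) (Fin p) ℝ} (hS : S.PosDef) :
    risk n (mle n) S = ENNReal.ofReal (∑ i : Fin p,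
      (Real.log n - ∫ x, Real.log x ∂(chiSq (n - i)))) := by
  have hn : ∀ i : Fin p, (0 : ℝ) < n := fun i => by
    have : 0 < n := i.pos.trans_le hnp
    exact_mod_cast this
  refine risk_eq_choleskyEst hnp (d := fun _ => (n : ℝ)) hn ?_ (fun A hA => ?_) hS
  · rw [← Finset.sum_mul, sum_steinEst_denominator]
    rcases p with _ | p
    · simp
    · rw [mul_assoc, mul_inv_cancel₀ (hn 0).ne', mul_one]
  · rw [choleskyEst, inv_diagonal_of_pos hn, mle]
    conv_lhs => rw [← (cholesky_spec p A hA).2.2]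
    have : (diagonal fun _ : Fin p => (n : ℝ)⁻¹) = (n : ℝ)⁻¹ • 1 := by
      rw [smul_one_eq_diagonal]
    rw [this]
    simp

/-- Concavity: log(c/n) ≤ c/n - 1, and the right sides sum to 0 since the denominators c average to
n. -/
theorem sum_log_denominator_le (hnp : p ≤ n) :
    ∑ i : Fin p, Real.log ((n : ℝ) + p - 2 * i - 1) ≤ ∑ _i : Fin p, Real.log n := by
  rcases p with _ | p
  · simp
  have hn : (0 : ℝ) < n := by
    have : 0 < n := by omega
    exact_mod_cast this
  have h : ∀ i : Fin (p + 1), Real.log ((n : ℝ) + (p + 1 : ℕ) - 2 * i - 1) - Real.log n ≤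
      ((n : ℝ) + (p + 1 : ℕ) - 2 * i - 1) * (n : ℝ)⁻¹ - 1 := fun i => by
    have hi := steinEst_denominator_pos hnp i
    rw [← Real.log_div hi.ne' hn.ne', ← div_eq_mul_inv]
    exact Real.log_le_sub_one_of_pos (div_pos hi hn)
  have hs := Finset.sum_le_sum fun i (_ : i ∈ Finset.univ) => h i
  rw [Finset.sum_sub_distrib, Finset.sum_sub_distrib, ← Finset.sum_mul, sum_steinEst_denominator,
    mul_assoc, mul_inv_cancel₀ hn.ne'] at hs
  simp at hs
  simpa using hs

end Covariance

end Risk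

/-! ### Products of measures with densities -/

section Product

theorem measurable_prod_eval {α : Type*} [MeasurableSpace α] {p : ℕ} {g : Fin p → α → ℝ≥0∞}
    (hg : ∀ i, Measurable (g i)) : Measurable fun x : Fin p → α => ∏ i, g i (x i) :=
  Finset.measurable_prod _ fun i _ => (hg i).comp (measurable_pi_apply i)

theorem lintegral_pi_prod {α : Type*} [MeasurableSpace α] (μ : Measure α) [SigmaFinite μ] :
    ∀ {p : ℕ} {g : Fin p → α → ℝ≥0∞}, (∀ i, Measurable (g i)) →
      ∫⁻ x, ∏ i, g i (x i) ∂(Measure.pi fun _ : Fin p => μ) = ∏ i, ∫⁻ x, g i x ∂μ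
  | 0, _, _ => by simp
  | p + 1, g, hg => by
    rw [lintegral_pi_vecCons μ (measurable_prod_eval hg)]
    simp only [Fin.prod_univ_succ, cons_val_zero, cons_val_succ]
    have h : ∀ v, ∫⁻ y : Fin p → α, g 0 v * ∏ i : Fin p, g i.succ (y i) ∂(Measure.pi fun _ => μ) =
        g 0 v * ∏ i : Fin p, ∫⁻ x, g i.succ x ∂μ := fun v => by
      rw [lintegral_const_mul _ (measurable_prod_eval fun i => hg i.succ), lintegral_pi_prod μ fun i => hg i.succ]
    simp only [h]
    rw [lintegral_mul_const _ (hg 0)]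

theorem pi_withDensity {α : Type*} [MeasurableSpace α] (μ : Measure α) [SigmaFinite μ]
    {p : ℕ} {g : Fin p → α → ℝ≥0∞} (hg : ∀ i, Measurable (g i))
    [∀ i, SigmaFinite (μ.withDensity (g i))] :
    (Measure.pi fun i => μ.withDensity (g i)) =
      (Measure.pi fun _ : Fin p => μ).withDensity fun x => ∏ i, g i (x i) := by
  refine Measure.pi_eq fun s hs => ?_
  rw [withDensity_apply _ (MeasurableSet.univ_pi hs),
    ← lintegral_indicator (MeasurableSet.univ_pi hs)]
  have h : ∀ x, (Set.univ.pi s).indicator (fun x => ∏ i, g i (x i)) x =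
      ∏ i, (s i).indicator (g i) (x i) := fun x => by
    by_cases hx : x ∈ Set.univ.pi s
    · rw [Set.indicator_of_mem hx]
      exact Finset.prod_congr rfl fun i _ => (Set.indicator_of_mem (hx i trivial) _).symm
    · rw [Set.indicator_of_notMem hx]
      rw [Set.mem_univ_pi, not_forall] at hx
      obtain ⟨i, hi⟩ := hx
      exact (Finset.prod_eq_zero (Finset.mem_univ i) (Set.indicator_of_notMem hi _)).symm
  simp only [h]
  rw [lintegral_pi_prod μ fun i => (hg i).indicator (hs i)]
  exact Finset.prod_congr rfl fun i _ => by
    rw [lintegral_indicator (hs i), withDensity_apply _ (hs i)]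

theorem lintegral_pi_gammaMeasure {p : ℕ} {a r : Fin p → ℝ} (ha : ∀ i, 0 < a i)
    (hr : ∀ i, 0 < r i) {F : (Fin p → ℝ) → ℝ≥0∞} (hF : Measurable F) :
    ∫⁻ x, F x ∂(Measure.pi fun i => gammaMeasure (a i) (r i)) =
      ∫⁻ x : Fin p → ℝ, (∏ i, gammaPDF (a i) (r i) (x i)) * F x := by
  have : ∀ i, IsProbabilityMeasure (volume.withDensity (gammaPDF (a i) (r i))) :=
    fun i => isProbabilityMeasure_gammaMeasure (ha i) (hr i)
  have h := pi_withDensity volume fun i => measurable_gammaPDF (a i) (r i)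
  simp only [gammaMeasure]
  rw [h, ← volume_pi, lintegral_withDensity_eq_lintegral_mul _
    (measurable_prod_eval fun i => measurable_gammaPDF (a i) (r i)) hF]
  rfl

end Product

/-! ### Posterior expected loss under products of gamma laws -/

section GammaProduct

variable {p : ℕ} {a r : Fin p → ℝ}

theorem ae_pos_pi_gammaMeasure (ha : ∀ i, 0 < a i) (hr : ∀ i, 0 < r i) :
    ∀ᵐ x ∂(Measure.pi fun i => gammaMeasure (a i) (r i)), ∀ i, 0 < x i := by
  have := fun i => isProbabilityMeasure_gammaMeasure (ha i) (hr i)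
  rw [ae_all_iff]
  exact fun i => (measurePreserving_eval (fun i => gammaMeasure (a i) (r i)) i
    ).quasiMeasurePreserving.ae (ae_pos_gammaMeasure _ _)

theorem integrable_comp_eval_gamma (ha : ∀ i, 0 < a i) (hr : ∀ i, 0 < r i) {i : Fin p} {f : ℝ → ℝ}
    (hf : Integrable f (gammaMeasure (a i) (r i))) :
    Integrable (fun x => f (x i)) (Measure.pi fun i => gammaMeasure (a i) (r i)) := by
  have := fun i => isProbabilityMeasure_gammaMeasure (ha i) (hr i)
  exact (measurePreserving_eval (fun i => gammaMeasure (a i) (r i)) i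
    ).integrable_comp_of_integrable hf

theorem integral_comp_eval_gamma (ha : ∀ i, 0 < a i) (hr : ∀ i, 0 < r i) {i : Fin p} {f : ℝ → ℝ}
    (hf : Integrable f (gammaMeasure (a i) (r i))) :
    ∫ x, f (x i) ∂(Measure.pi fun i => gammaMeasure (a i) (r i)) =
      ∫ x, f x ∂(gammaMeasure (a i) (r i)) := by
  have := fun i => isProbabilityMeasure_gammaMeasure (ha i) (hr i)
  exact MeasureTheory.integral_comp_eval hf.aestronglyMeasurable

/-- The posterior expected Stein loss is bounded below by its value at the Bayes estimator. -/
theorem le_lintegral_steinLoss_gamma (ha : ∀ i, 0 < a i) (hr : ∀ i, 0 < r i)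
    {B : Matrix (Fin p) (Fin p) ℝ} (hB : B.PosDef) :
    ENNReal.ofReal (∑ i, (Real.log (a i) - ∫ x, Real.log x ∂(gammaMeasure (a i) 1))) ≤
      ∫⁻ l, ENNReal.ofReal (∑ i, l i * B i i - ∑ i, Real.log (l i) + (-Real.log B.det - p))
        ∂(Measure.pi fun i => gammaMeasure (a i) (r i)) := by
  have := fun i => isProbabilityMeasure_gammaMeasure (ha i) (hr i)
  have hid := fun i => integrable_id_gammaMeasure (ha i) (hr i)
  have hlog := fun i => integrable_log_gammaMeasure (ha i) (hr i)
  have j1 := fun i => (integrable_comp_eval_gamma ha hr (hid i)).mul_const (B i i)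
  have j2 := fun i => integrable_comp_eval_gamma ha hr (hlog i)
  have i1 := integrable_finsetSum Finset.univ fun i _ => j1 i
  have i2 := integrable_finsetSum Finset.univ fun i _ => j2 i
  have hnn : 0 ≤ᵐ[Measure.pi fun i => gammaMeasure (a i) (r i)] fun l =>
      ∑ i, l i * B i i - ∑ i, Real.log (l i) + (-Real.log B.det - p) := by
    filter_upwards [ae_pos_pi_gammaMeasure ha hr] with l hl
    have h := steinLoss_nonneg hB (posDef_diagonal fun i => inv_pos.2 (hl i))
    rw [steinLoss_diagonal_inv hB hl] at h
    simp only [Pi.zero_apply]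
    linarith
  have hfi : Integrable (fun l : Fin p → ℝ => ∑ i, l i * B i i - ∑ i, Real.log (l i) +
      (-Real.log B.det - p)) (Measure.pi fun i => gammaMeasure (a i) (r i)) :=
    (i1.sub i2).add (integrable_const _)
  rw [← ofReal_integral_eq_lintegral_ofReal hfi hnn]
  refine ENNReal.ofReal_le_ofReal ?_
  -- With posterior means a/r of the precisions, the excess over the bound is the Stein loss of B
  -- relative to Diag(r/a). The terms log r cancel, so the bound depends on the shapes alone.
  have hd : ∀ i, 0 < a i / r i := fun i => div_pos (ha i) (hr i)
  have h := steinLoss_nonneg hB (posDef_diagonal fun i => inv_pos.2 (hd i))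
  rw [steinLoss_diagonal_inv hB hd] at h
  rw [integral_sub_add_const i1 i2, integral_finsetSum _ fun i _ => j1 i,
    integral_finsetSum _ fun i _ => j2 i]
  simp only [integral_mul_const, integral_comp_eval_gamma ha hr (hid _),
    integral_comp_eval_gamma ha hr (hlog _), integral_id_gammaMeasure (ha _) (hr _),
    integral_log_gammaMeasure (ha _) (hr _), Finset.sum_sub_distrib]
  simp only [Real.log_div (ha _).ne' (hr _).ne', Finset.sum_sub_distrib] at h
  linarith

end GammaProduct

/-! ### Gamma priors and minimaxity -/

theorem measurable_gammaPDF_uncurry (a : ℝ) :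
    Measurable fun z : ℝ × ℝ => gammaPDF a z.1 z.2 := by
  unfold gammaPDF gammaPDFReal
  refine Measurable.ennreal_ofReal (Measurable.ite (measurableSet_Ici.preimage measurable_snd) ?_
    measurable_const)
  fun_prop

theorem measurable_predictivePDF (a e : ℝ) : Measurable (predictivePDF a e) := by
  unfold predictivePDF
  refine Measurable.ite measurableSet_Ioi ?_ measurable_const
  fun_prop

/-- The predictive density is a marginal of the joint density of rate and observation, so Tonelli
gives total mass 1 without evaluating a beta integral. -/
theorem lintegral_predictivePDF {a e : ℝ} (ha : 0 < a) (he : 0 < e) :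
    ∫⁻ x, predictivePDF a e x = 1 := by
  have h1 : ∀ x, predictivePDF a e x =
      ∫⁻ l, predictivePDF a e x * gammaPDF (a + e) (1 + x / 2) l := fun x => by
    rw [lintegral_const_mul _ (measurable_gammaPDF _ _)]
    by_cases hx : 0 < x
    · rw [lintegral_gammaPDF_eq_one (add_pos ha he) (by positivity), mul_one]
    · rw [predictivePDF, if_neg hx, zero_mul]
  have h2 : ∀ᵐ x : ℝ, predictivePDF a e x =
      ∫⁻ l, gammaPDF e 1 l * gammaPDF a (l / 2) x := by
    filter_upwards [Measure.ae_ne volume (0 : ℝ)] with x hx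
    rw [h1 x]
    refine lintegral_congr_ae ?_
    filter_upwards [Measure.ae_ne volume (0 : ℝ)] with l hl
    rw [gammaPDF_mul_gammaPDF ha he hl hx]
  have hm : Measurable fun z : ℝ × ℝ => gammaPDF e 1 z.2 * gammaPDF a (z.2 / 2) z.1 :=
    ((measurable_gammaPDF e 1).comp measurable_snd).mul
      ((measurable_gammaPDF_uncurry a).comp (by fun_prop : Measurable fun z : ℝ × ℝ =>
        (z.2 / 2, z.1)))
  rw [lintegral_congr_ae h2, lintegral_lintegral_swap hm.aemeasurable,
    ← lintegral_gammaPDF_eq_one he one_pos]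
  refine lintegral_congr_ae ?_
  filter_upwards [Measure.ae_ne volume (0 : ℝ)] with l hl
  rw [lintegral_const_mul _ (measurable_gammaPDF _ _)]
  rcases lt_or_gt_of_ne hl with h | h
  · rw [gammaPDF_of_neg h, zero_mul]
  · rw [lintegral_gammaPDF_eq_one ha (by positivity), mul_one]

section Bayes

open Filter Topology

variable {n p : ℕ}

theorem pivots_diagonal {s : Fin p → ℝ} (hs : ∀ i, 0 < s i) : pivots p (diagonal s) = s := by
  funext i
  have h := cholesky_mul_transpose (T := diagonal fun i => √(s i))
    (fun i j hij => diagonal_apply_ne _ hij.ne) (fun i => by simpa using hs i)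
  have e := diagonal_sqrt_mul_self hs
  rw [Matrix.mul_one] at e
  rw [e] at h
  rw [pivots_eq_sq_cholesky (posDef_diagonal hs), h, diagonal_apply_eq, Real.sq_sqrt (hs i).le]

/-- The values of an estimator at the positive diagonal matrices, extended by the identity. -/
noncomputable def extendByOne (φ : Matrix (Fin p) (Fin p) ℝ → Matrix (Fin p) (Fin p) ℝ)
    (x : Fin p → ℝ) : Matrix (Fin p) (Fin p) ℝ :=
  open Classical in if ∀ i, 0 < x i then φ (diagonal x) else 1

variable {φ : Matrix (Fin p) (Fin p) ℝ → Matrix (Fin p) (Fin p) ℝ}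

theorem IsEstimator.posDef_extendByOne (hφ : IsEstimator φ) (x : Fin p → ℝ) :
    (extendByOne φ x).PosDef := by
  rw [extendByOne]
  split_ifs with h
  · exact hφ.posDef x h
  · exact Matrix.PosDef.one

theorem IsEstimator.measurable_extendByOne (hφ : IsEstimator φ) (i j : Fin p) :
    Measurable fun x => extendByOne φ x i j := by
  classical
  have hs : MeasurableSet {x : Fin p → ℝ | ∀ i, 0 < x i} := by
    simp only [Set.ofPred_forall]
    exact MeasurableSet.iInter fun i => measurableSet_lt measurable_const (measurable_pi_apply i)
  have h := Measurable.dite (s := {x : Fin p → ℝ | ∀ i, 0 < x i}) (hφ.measurable i j)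
    (g := fun _ => (1 : Matrix (Fin p) (Fin p) ℝ) i j) measurable_const hs
  convert h using 2 with x
  simp only [extendByOne, Set.mem_ofPred_eq]
  split_ifs <;> rfl

/-- The Stein loss at the estimate `extendByOne φ x` of the diagonal matrix `Diag(l)⁻¹`. -/
noncomputable def precisionLoss (φ : Matrix (Fin p) (Fin p) ℝ → Matrix (Fin p) (Fin p) ℝ)
    (l x : Fin p → ℝ) : ℝ≥0∞ :=
  ENNReal.ofReal (∑ i, l i * extendByOne φ x i i - ∑ i, Real.log (l i) +
    (-Real.log (extendByOne φ x).det - p))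

theorem IsEstimator.measurable_precisionLoss (hφ : IsEstimator φ) :
    Measurable fun z : (Fin p → ℝ) × (Fin p → ℝ) => precisionLoss φ z.1 z.2 := by
  have h1 : ∀ i j, Measurable fun z : (Fin p → ℝ) × (Fin p → ℝ) => extendByOne φ z.2 i j :=
    fun i j => (hφ.measurable_extendByOne i j).comp measurable_snd
  have h2 := measurable_det h1
  have h3 : ∀ i, Measurable fun z : (Fin p → ℝ) × (Fin p → ℝ) => z.1 i := by fun_prop
  unfold precisionLoss
  refine Measurable.ennreal_ofReal (((Finset.measurable_sum _ fun i _ => (h3 i).mul (h1 i i)).sub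
    (Finset.measurable_sum _ fun i _ => (h3 i).log)).add (h2.log.neg.sub measurable_const))

theorem IsEstimator.measurable_precisionLoss_right (hφ : IsEstimator φ) (l : Fin p → ℝ) :
    Measurable fun x => precisionLoss φ l x := by
  have h : Measurable fun x : Fin p → ℝ => (l, x) := measurable_prodMk_left
  simpa only [Function.comp_def] using hφ.measurable_precisionLoss.comp h

theorem IsEstimator.measurable_precisionLoss_left (hφ : IsEstimator φ) (x : Fin p → ℝ) :
    Measurable fun l => precisionLoss φ l x := by
  have h : Measurable fun l : Fin p → ℝ => (l, x) := measurable_prodMk_right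
  simpa only [Function.comp_def] using hφ.measurable_precisionLoss.comp h

theorem map_mul_pi_gammaMeasure {a r c : Fin p → ℝ} (ha : ∀ i, 0 < a i) (hr : ∀ i, 0 < r i)
    (hc : ∀ i, 0 < c i) :
    (Measure.pi fun i => gammaMeasure (a i) (r i)).map (fun w i => c i * w i) =
      Measure.pi fun i => gammaMeasure (a i) (r i / c i) := by
  have hg : ∀ i, (gammaMeasure (a i) (r i)).map (fun x => c i * x) =
      gammaMeasure (a i) (r i / c i) := fun i => map_mul_gammaMeasure (ha i) (hr i) (hc i)
  have : ∀ i, IsProbabilityMeasure ((gammaMeasure (a i) (r i)).map (fun x => c i * x)) :=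
    fun i => by
      rw [hg i]
      exact isProbabilityMeasure_gammaMeasure (ha i) (div_pos (hr i) (hc i))
  rw [Measure.pi_map_pi (f := fun i x => c i * x) (fun i => by fun_prop)]
  simp only [hg]

/-- The pivots of A are χ² variables divided by l_i, hence gamma of rate l_i / 2, the form conjugate
to a gamma prior on l_i. -/
theorem starRisk_diagonal_inv (hnp : p ≤ n) (hφ : IsEstimator φ) {l : Fin p → ℝ}
    (hl : ∀ i, 0 < l i) :
    starRisk n φ (diagonal fun i => (l i)⁻¹) =
      ∫⁻ x, precisionLoss φ l x
        ∂(Measure.pi fun i : Fin p => gammaMeasure (((n - i : ℕ) : ℝ) / 2) (l i / 2)) := by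
  have hk : ∀ i : Fin p, (0 : ℝ) < ((n - i : ℕ) : ℝ) / 2 := fun i => by
    have : 0 < n - i := by omega
    positivity
  have hli : ∀ i, 0 < (l i)⁻¹ := fun i => inv_pos.2 (hl i)
  have hF := hφ.measurable_precisionLoss_right l
  have hmul : Measurable fun (w : Fin p → ℝ) i => (l i)⁻¹ * w i := by fun_prop
  have hmap := map_mul_pi_gammaMeasure hk (r := fun _ => 1 / 2) (fun _ => one_half_pos) hli
  have hr : ∀ i, 1 / 2 / (l i)⁻¹ = l i / 2 := fun i => by
    rw [div_inv_eq_mul]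
    ring
  simp only [hr] at hmap
  have hpiv := map_pivots_columnLaw hnp
  simp only [chiSq] at hpiv
  rw [← hmap, lintegral_map hF hmul, ← hpiv,
    lintegral_map (f := fun w => precisionLoss φ l fun i => (l i)⁻¹ * w i) (hF.comp hmul)
      (measurable_pivots_gram p),
    starRisk_eq_lintegral hnp φ (posDef_diagonal hli), pivots_diagonal hli]
  refine lintegral_congr_ae ?_
  filter_upwards [ae_posDef_gram_columnLaw hnp] with Y hY
  have hx : ∀ i, 0 < (l i)⁻¹ * pivots p (gram ℝ Y) i :=
    fun i => mul_pos (hli i) (pivots_pos hY i)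
  rw [steinLoss_diagonal_inv (hφ.posDef _ hx) hl, precisionLoss, extendByOne, if_pos hx]
  congr 1
  ring

/-- Tonelli and Bayes' formula rewrite the average risk as the posterior expected loss integrated
against the predictive law. The posterior bound is constant in x and the predictive law has mass 1,
so the bound survives integration. -/
theorem le_lintegral_starRisk (hnp : p ≤ n) (hφ : IsEstimator φ) {e : ℝ} (he : 0 < e) :
    ENNReal.ofReal (∑ i : Fin p, (Real.log (((n - i : ℕ) : ℝ) / 2 + e) -
        ∫ x, Real.log x ∂(gammaMeasure (((n - i : ℕ) : ℝ) / 2 + e) 1))) ≤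
      ∫⁻ l, starRisk n φ (diagonal fun i => (l i)⁻¹)
        ∂(Measure.pi fun _ : Fin p => gammaMeasure e 1) := by
  let a : Fin p → ℝ := fun i => ((n - i : ℕ) : ℝ) / 2
  have ha : ∀ i, 0 < a i := fun i => by
    have : 0 < n - i := by omega
    simp only [a]
    positivity
  have hF := hφ.measurable_precisionLoss
  have hae0 : ∀ᵐ x : Fin p → ℝ, ∀ i, x i ≠ 0 :=
    ae_all_iff.2 fun i => Measure.ae_eval_ne (μ := fun _ : Fin p => (volume : Measure ℝ)) i 0
  let G : (Fin p → ℝ) → (Fin p → ℝ) → ℝ≥0∞ := fun l x =>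
    (∏ i, gammaPDF e 1 (l i)) * ((∏ i, gammaPDF (a i) (l i / 2) (x i)) * precisionLoss φ l x)
  have hpr : ∀ i, Measurable fun z : (Fin p → ℝ) × (Fin p → ℝ) => gammaPDF (a i) (z.1 i / 2) (z.2 i) :=
    fun i => (measurable_gammaPDF_uncurry (a i)).comp (by fun_prop :
      Measurable fun z : (Fin p → ℝ) × (Fin p → ℝ) => (z.1 i / 2, z.2 i))
  have hlik : Measurable fun z : (Fin p → ℝ) × (Fin p → ℝ) =>
      (∏ i, gammaPDF (a i) (z.1 i / 2) (z.2 i)) * precisionLoss φ z.1 z.2 :=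
    (Finset.measurable_prod _ fun i _ => hpr i).mul hF
  have hG : Measurable (Function.uncurry G) :=
    (Finset.measurable_prod _ fun i _ => (measurable_gammaPDF e 1).comp
      ((measurable_pi_apply i).comp measurable_fst)).mul hlik
  have h1 : ∫⁻ l, starRisk n φ (diagonal fun i => (l i)⁻¹)
      ∂(Measure.pi fun _ : Fin p => gammaMeasure e 1) = ∫⁻ l, ∫⁻ x, G l x := by
    have : ∫⁻ l, starRisk n φ (diagonal fun i => (l i)⁻¹)
        ∂(Measure.pi fun _ : Fin p => gammaMeasure e 1) =
        ∫⁻ l, (∫⁻ x : Fin p → ℝ, (∏ i, gammaPDF (a i) (l i / 2) (x i)) * precisionLoss φ l x)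
          ∂(Measure.pi fun _ : Fin p => gammaMeasure e 1) := by
      refine lintegral_congr_ae ?_
      filter_upwards [ae_pos_pi_gammaMeasure (fun _ => he) (fun _ => one_pos)] with l hl
      rw [starRisk_diagonal_inv hnp hφ hl]
      exact lintegral_pi_gammaMeasure ha (fun i => half_pos (hl i))
        (hφ.measurable_precisionLoss_right l)
    rw [this, lintegral_pi_gammaMeasure (fun _ => he) (fun _ => one_pos) hlik.lintegral_prod_right']
    refine lintegral_congr fun l => ?_
    exact (lintegral_const_mul _ (hlik.comp measurable_prodMk_left)).symm
  rw [h1, lintegral_lintegral_swap hG.aemeasurable]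
  have h2 : ∫⁻ x : Fin p → ℝ, ∏ i, predictivePDF (a i) e (x i) = 1 := by
    rw [volume_pi, lintegral_pi_prod volume fun i => measurable_predictivePDF (a i) e]
    exact Finset.prod_eq_one fun i _ => lintegral_predictivePDF (ha i) he
  have hm : Measurable fun x : Fin p → ℝ => ∏ i, predictivePDF (a i) e (x i) :=
    Finset.measurable_prod _ fun i _ => (measurable_predictivePDF _ _).comp (measurable_pi_apply i)
  set V := ENNReal.ofReal (∑ i : Fin p, (Real.log (((n - i : ℕ) : ℝ) / 2 + e) -
        ∫ x, Real.log x ∂(gammaMeasure (((n - i : ℕ) : ℝ) / 2 + e) 1))) with hV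
  calc V = ∫⁻ x : Fin p → ℝ, (∏ i, predictivePDF (a i) e (x i)) * V := by
        rw [lintegral_mul_const _ hm, h2, one_mul]
    _ ≤ ∫⁻ x, ∫⁻ l, G l x := by
        refine lintegral_mono_ae ?_
        filter_upwards [hae0] with x hx
        have e1 : ∫⁻ l, G l x = (∏ i, predictivePDF (a i) e (x i)) *
            ∫⁻ l : Fin p → ℝ, (∏ i, gammaPDF (a i + e) (1 + x i / 2) (l i)) *
              precisionLoss φ l x := by
          have hpost : Measurable fun l : Fin p → ℝ =>
              (∏ i, gammaPDF (a i + e) (1 + x i / 2) (l i)) * precisionLoss φ l x :=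
            (measurable_prod_eval fun i => measurable_gammaPDF (a i + e) (1 + x i / 2)).mul
              (hφ.measurable_precisionLoss_left x)
          rw [← lintegral_const_mul _ hpost]
          refine lintegral_congr_ae ?_
          filter_upwards [hae0] with l hl
          simp only [G]
          rw [← mul_assoc, ← mul_assoc, ← Finset.prod_mul_distrib, ← Finset.prod_mul_distrib]
          congr 1
          exact Finset.prod_congr rfl fun i _ => gammaPDF_mul_gammaPDF (ha i) he (hl i) (hx i)
        rw [e1]
        by_cases hpos : ∀ i, 0 < x i
        · have hr : ∀ i, 0 < 1 + x i / 2 := fun i => by linarith [hpos i]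
          have hae : ∀ i, 0 < a i + e := fun i => add_pos (ha i) he
          rw [← lintegral_pi_gammaMeasure hae hr (hφ.measurable_precisionLoss_left x)]
          exact mul_le_mul_right
            (le_lintegral_steinLoss_gamma hae hr (hφ.posDef_extendByOne x)) _
        · obtain ⟨i, hi⟩ := not_forall.1 hpos
          rw [Finset.prod_eq_zero (Finset.mem_univ i) (by rw [predictivePDF, if_neg hi]), zero_mul]
          exact zero_le

theorem tendsto_bayes_risk (hnp : p ≤ n) :
    Tendsto (fun e : ℝ => ∑ i : Fin p, (Real.log (((n - i : ℕ) : ℝ) / 2 + e) -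
      ∫ x, Real.log x ∂(gammaMeasure (((n - i : ℕ) : ℝ) / 2 + e) 1))) (𝓝[>] 0)
      (𝓝 (minRisk n p)) := by
  rw [minRisk]
  refine tendsto_finsetSum _ fun i _ => ?_
  have hk : (0 : ℝ) < ((n - i : ℕ) : ℝ) := by
    have : 0 < n - i := by omega
    exact_mod_cast this
  have hk2 := half_pos hk
  -- Passing from rate 1/2 to rate 1 shifts both terms by log 2, so their difference is unchanged.
  have e : Real.log ((n : ℝ) - i) - ∫ x, Real.log x ∂(chiSq (n - i)) =
      Real.log (((n - i : ℕ) : ℝ) / 2) - ∫ x, Real.log x ∂(gammaMeasure (((n - i : ℕ) : ℝ) / 2) 1) := by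
    rw [chiSq, integral_log_gammaMeasure hk2 (by norm_num), Real.log_div hk.ne' two_ne_zero,
      one_div, Real.log_inv, Nat.cast_sub (i.2.le.trans hnp)]
    ring
  rw [e]
  refine Tendsto.sub ?_ (tendsto_integral_log_gammaMeasure hk2)
  have hc : ContinuousAt (fun e : ℝ => Real.log (((n - i : ℕ) : ℝ) / 2 + e)) 0 :=
    ContinuousAt.log (by fun_prop) (by simpa using hk2.ne')
  have := hc.tendsto
  simp only [add_zero] at this
  exact this.mono_left nhdsWithin_le_nhds

/-- The priors are probability measures, so each average risk is at most the supremum; then e tends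
to 0. -/
theorem minRisk_le_iSup_starRisk (hnp : p ≤ n) (hφ : IsEstimator φ) :
    ENNReal.ofReal (minRisk n p) ≤
      ⨆ (S : Matrix (Fin p) (Fin p) ℝ) (_ : S.PosDef), starRisk n φ S := by
  refine le_of_tendsto ((ENNReal.continuous_ofReal.tendsto _).comp (tendsto_bayes_risk hnp)) ?_
  filter_upwards [self_mem_nhdsWithin] with e he
  have he : 0 < e := he
  have := isProbabilityMeasure_gammaMeasure he one_pos
  refine (le_lintegral_starRisk hnp hφ he).trans ((lintegral_mono_ae
    (g := fun _ => ⨆ (S : Matrix (Fin p) (Fin p) ℝ) (_ : S.PosDef), starRisk n φ S) ?_).trans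
      (by simp))
  filter_upwards [ae_pos_pi_gammaMeasure (fun _ => he) (fun _ => one_pos)] with l hl
  exact le_iSup₂_of_le _ (posDef_diagonal fun i => inv_pos.2 (hl i)) le_rfl

end Bayes

end Iwasawa

theorem theorem1 (n p : ℕ) (hnp : p ≤ n) :
    -- the estimator `D₀⁻¹ A*` belongs to the class of invariant estimators
    Iwasawa.IsEstimator (Iwasawa.bestEst n (p := p)) ∧
    Iwasawa.IsInvariant (Iwasawa.bestEst n (p := p)) ∧
    -- it is the best one, and the only best one
    (∀ φ : Matrix (Fin p) (Fin p) ℝ → Matrix (Fin p) (Fin p) ℝ,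
      Iwasawa.IsEstimator φ → Iwasawa.IsInvariant φ →
      ∀ S : Matrix (Fin p) (Fin p) ℝ, S.PosDef →
        Iwasawa.starRisk n (Iwasawa.bestEst n) S ≤ Iwasawa.starRisk n φ S ∧
        (Iwasawa.starRisk n φ S = Iwasawa.starRisk n (Iwasawa.bestEst n) S →
          ∀ a : Fin p → ℝ, (∀ i, 0 < a i) →
            φ (Matrix.diagonal a) = Iwasawa.bestEst n (Matrix.diagonal a))) ∧
    -- the minimum risk
    (∀ i : Fin p, MeasureTheory.Integrable Real.log (Iwasawa.chiSq (n - i))) ∧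
    (∀ S : Matrix (Fin p) (Fin p) ℝ, S.PosDef →
      Iwasawa.starRisk n (Iwasawa.bestEst n) S ≠ ⊤ ∧
      (Iwasawa.starRisk n (Iwasawa.bestEst n) S).toReal = Iwasawa.minRisk n p) ∧
    -- minimaxity
    (∀ φ : Matrix (Fin p) (Fin p) ℝ → Matrix (Fin p) (Fin p) ℝ, Iwasawa.IsEstimator φ →
      (⨆ (S : Matrix (Fin p) (Fin p) ℝ) (_ : S.PosDef),
        Iwasawa.starRisk n (Iwasawa.bestEst n) S) ≤
      ⨆ (S : Matrix (Fin p) (Fin p) ℝ) (_ : S.PosDef), Iwasawa.starRisk n φ S) ∧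
    -- comparison with the Cholesky estimator and the maximum likelihood estimator
    (∀ S : Matrix (Fin p) (Fin p) ℝ, S.PosDef →
      Iwasawa.starRisk n (Iwasawa.bestEst n) S ≤ Iwasawa.risk n (Iwasawa.steinEst n) S ∧
      Iwasawa.risk n (Iwasawa.steinEst n) S ≤ Iwasawa.risk n (Iwasawa.mle n) S) := by
  refine ⟨Iwasawa.isEstimator_bestEst hnp, Iwasawa.isInvariant_bestEst hnp,
    fun φ hφ hinv S hS => ⟨Iwasawa.starRisk_bestEst_le hnp hinv hφ hS,
      fun he a ha => Iwasawa.eq_bestEst_of_starRisk_eq hnp hinv hφ hS he ha⟩,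
    fun i => Iwasawa.integrable_log_chiSq (by omega), fun S hS => ?_, fun φ hφ => ?_,
    fun S hS => ⟨?_, ?_⟩⟩
  · obtain ⟨h1, h2⟩ := Iwasawa.starRisk_bestEst hnp hS
    rw [h1, ENNReal.toReal_ofReal h2]
    exact ⟨ENNReal.ofReal_ne_top, rfl⟩
  -- The risk of the best invariant estimator is the same for every S, so its supremum is the
  -- minimum risk.
  · refine iSup₂_le fun S hS => ?_
    rw [(Iwasawa.starRisk_bestEst hnp hS).1]
    exact Iwasawa.minRisk_le_iSup_starRisk hnp hφ
  · rw [(Iwasawa.starRisk_bestEst hnp hS).1, Iwasawa.risk_steinEst hnp hS]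
    refine ENNReal.ofReal_le_ofReal (Finset.sum_le_sum fun i _ => sub_le_sub_right ?_ _)
    exact Real.log_le_log (Iwasawa.sub_val_pos hnp i) (Iwasawa.steinEst_denominator_ge n i)
  · rw [Iwasawa.risk_steinEst hnp hS, Iwasawa.risk_mle hnp hS]
    refine ENNReal.ofReal_le_ofReal ?_
    rw [Finset.sum_sub_distrib, Finset.sum_sub_distrib]
    exact sub_le_sub_right (Iwasawa.sum_log_denominator_le hnp) _
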